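/- Let $m:\mathbb Z\to\,]0,+\infty[$ satisfy $m(-\nu)=m(\nu)$ for all $\nu\in\mathbb Z$ and $\sum_{\nu\in\mathbb Z}(1+|\nu|)\,m(\nu)<\infty$, and let $(a_\nu)_{\nu\in\mathbb Z}$ be complex numbers such that, for some constant $C$, $|a_\nu|\le C\,m(\nu)$ for all $\nu\in\mathbb Z$. Let $p:S^1\to\mathbb C$, $p(\zeta)=\sum_{\nu\in\mathbb Z}a_\nu\zeta^\nu$, be the associated symbol on the unit circle $S^1\subset\mathbb C$, and for $N\ge1$ let $P_N=(a_{j-k})_{0\le j,k<N}$ be the associated $N\times N$ Toeplitz matrix. On a probability space, let $Q_\omega=Q_\omega(N)$, $N\ge1$, be random complex $N\times N$ matrices with law $\pi^{-N^2}e^{-\|Q\|_{\mathrm{HS}}^2}\,L(dQ)$, where $\|Q\|_{\mathrm{HS}}^2=\sum_{j,k}|q_{j,k}|^2$ and $L$ is Lebesgue measure on $\mathbb C^{N\times N}$ (that is, the entries of $Q_\omega(N)$ are independent standard complex Gaussian variables; nothing is assumed on the joint law for different $N$). Let $\delta_0\in\,]0,1[$ and $\delta_1>3/2$, and let $\delta=\delta(N)$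 be real numbers with $$e^{-N^{\delta_0}}\le\delta(N)\ \text{ for all sufficiently large } N,\qquad \delta(N)=O(N^{-\delta_1})\ \text{ as } N\to\infty .$$ Put $P_N^\delta=P_N+\delta(N)\,Q_\omega(N)$ and let $$\xi_N=\frac1N\sum_{\lambda\in\mathrm{Spec}(P_N^\delta)}\delta_\lambda$$ be the empirical measure of its eigenvalues, counted with algebraic multiplicity, where $\delta_\lambda$ is the Dirac measure at $\lambda$. Then, almost surely, $$\xi_N\rightharpoonup p_*\Big(\frac1{2\pi}L_{S^1}\Big)\qquad (N\to\infty)$$ weakly, i.e. $\int f\,d\xi_N\to\int f\,d\big(p_*(\tfrac1{2\pi}L_{S^1})\big)$ for every bounded continuous function $f$ on $\mathbb C$. Here $L_{S^1}$ is the Lebesgue (arc length) measure on $S^1$, and $p_*$ denotes push-forward of measures by $p$. -/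

import Mathlib

open MeasureTheory ProbabilityTheory Filter Topology Asymptotics
open scoped Real NNReal ENNReal

noncomputable section

/-- The Borel `σ`-algebra of the unit circle `S¹ ⊂ ℂ`. -/
instance circleMeasurableSpace : MeasurableSpace Circle := borel Circle

instance circleBorelSpace : BorelSpace Circle := ⟨rfl⟩

/-- The symbol `p : S¹ → ℂ`, `p(ζ) = ∑_{ν ∈ ℤ} a_ν ζ^ν`. -/
def toeplitzSymbol (a : ℤ → ℂ) (ζ : Circle) : ℂ :=
  ∑' ν : ℤ, a ν * (ζ : ℂ) ^ ν

/-- The `N × N` Toeplitz matrix `P_N = 1_{[0,N[} p(τ) 1_{[0,N[}`, where `τ u(j) = u(j - 1)`,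
so that `(p(τ) u)(j) = ∑_k a_{j-k} u(k)`. -/
def toeplitzMatrix (a : ℤ → ℂ) (N : ℕ) : Matrix (Fin N) (Fin N) ℂ :=
  Matrix.of fun j k => a ((j : ℤ) - (k : ℤ))

/-- The complex Gaussian law `π^{-N²} exp(-‖Q‖²_HS) L(dQ)` on `N × N` complex matrices, where `L`
is Lebesgue measure and `‖Q‖²_HS = ∑_{j,k} |q_{j,k}|²`. -/
def complexGinibre (N : ℕ) : Measure (Fin N → Fin N → ℂ) :=
  (volume : Measure (Fin N → Fin N → ℂ)).withDensity fun Q =>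
    ENNReal.ofReal ((π ^ (N ^ 2))⁻¹ * Real.exp (-∑ j, ∑ k, ‖Q j k‖ ^ 2))

/-- The randomly perturbed Toeplitz matrix `P_N^δ = P_N + δ Q`. -/
def perturbedToeplitz (a : ℤ → ℂ) (N : ℕ) (δ : ℝ) (Q : Fin N → Fin N → ℂ) :
    Matrix (Fin N) (Fin N) ℂ :=
  toeplitzMatrix a N + (δ : ℂ) • Matrix.of Q

/-- The Dirac measure `δ_z` at `z ∈ ℂ`, as a finite measure. -/
def diracMeasure (z : ℂ) : FiniteMeasure ℂ :=
  ⟨Measure.dirac z, inferInstance⟩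

/-- The empirical eigenvalue measure `N⁻¹ ∑_λ δ_λ` of an `N × N` matrix, the sum running over the
eigenvalues `λ` counted with algebraic multiplicity. -/
def empiricalMeasure {N : ℕ} (A : Matrix (Fin N) (Fin N) ℂ) : FiniteMeasure ℂ :=
  (N : ℝ≥0)⁻¹ • (A.charpoly.roots.map diracMeasure).sum

/-- The Lebesgue (arc length) measure `L_{S¹}` on the unit circle, of total mass `2π`: the image
of Lebesgue measure on `(-π, π]` under `θ ↦ e^{iθ}`. -/
def arcLengthMeasure : FiniteMeasure Circle :=
  ⟨((volume : Measure ℝ).restrict (Set.Ioc (-π) π)).map Circle.exp, inferInstance⟩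

/-- The push-forward `p_*((2π)⁻¹ L_{S¹})` of the uniform measure on the circle by the symbol. -/
def symbolMeasure (a : ℤ → ℂ) : FiniteMeasure ℂ :=
  (Real.toNNReal (2 * π)⁻¹ • arcLengthMeasure).map (toeplitzSymbol a)

end

/-! ### Determinant bounds under small-norm and few-row perturbations -/

section Determinants

open Matrix
open scoped Matrix.Norms.L2Operator

variable {n : Type*} [Fintype n] [DecidableEq n]

/-! Weak convergence is deduced from convergence, for almost every $z$, of the logarithmic
potentials. Off the spectrum the potential of $\xi_N$ at $z$ is $\frac1N\log|\det(P_N^\delta-z)|$,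
and that of the limit is the circle mean of $\log|p-z|$. The curve $p(S^1)$ is a Lipschitz image of
the line, hence null, so $p-z$ may be taken nonvanishing.

The determinant is compared with that of the circulant matrix with eigenvalues $p(e^{2\pi il/N})-z$,
whose normalised log-determinant is a Riemann sum for the desired mean. Split $p-z$ into a
trigonometric polynomial of degree $d$ and a small tail. The tail and $\delta Q$ are small in
operator norm and move the log-determinant by $O(\eta N)$. For the polynomial part, Toeplitz and
circulant matrices differ only in $2d$ rows, so the determinant ratio is a $2d\times2d$ determinant,
controlled both ways by entries of the two inverses (`norm_det_le_of_rows`,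
`abs_log_norm_det_sub_le`). Subexponential inverse bounds therefore suffice, whatever the winding
number of $p-z$ about $0$.

On the circulant side the inverse is bounded since $|p-z|\ge c>0$. On the Toeplitz side the noise
provides the bound: the determinant is affine in each entry of $Q$ with slope $\delta$ times a
cofactor, so it is rarely small relative to that cofactor (`complexGinibre_adjugate_gt_le`). A union
bound and Borel–Cantelli give inverse entries at most $N^2/\delta$, and $\delta\ge
e^{-N^{\delta_0}}$ makes this subexponential. Second moments and $\delta_1>3/2$ give $\|\delta
Q\|\to0$; Fubini exchanges "each $z$, almost surely" for "almost surely, almost every $z$".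

Potentials of probability measures in a fixed disc are uniformly integrable on compact sets, so
Vitali's theorem allows integration against bounded densities. Test functions are approximated by
such potentials using differences of circle means of $\log|z-w|$
(`tendsto_integral_of_tendsto_logPotential`). -/

theorem Multiset.norm_prod_bounds {lo hi : ℝ} (hlo : 0 ≤ lo) (s : Multiset ℂ)
    (h : ∀ r ∈ s, lo ≤ ‖r‖ ∧ ‖r‖ ≤ hi) :
    lo ^ s.card ≤ ‖s.prod‖ ∧ ‖s.prod‖ ≤ hi ^ s.card := by
  induction s using Multiset.induction with
  | empty => simp
  | cons a s ih =>
    obtain ⟨h1, h2⟩ := ih fun r hr => h r (Multiset.mem_cons_of_mem hr)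
    obtain ⟨h3, h4⟩ := h a (Multiset.mem_cons_self a s)
    simp only [Multiset.prod_cons, Multiset.card_cons, norm_mul, pow_succ']
    exact ⟨mul_le_mul h3 h1 (by positivity) (by positivity),
      mul_le_mul h4 h2 (by positivity) (by linarith [norm_nonneg a])⟩

theorem Matrix.norm_le_of_mem_roots_charpoly (A : Matrix n n ℂ) {r : ℂ}
    (hr : r ∈ A.charpoly.roots) : ‖r‖ ≤ ‖A‖ := by
  have hroot := Polynomial.isRoot_of_mem_roots hr
  rcases isEmpty_or_nonempty n with h | h
  · simp [Matrix.charpoly] at hr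
  · exact spectrum.norm_le_norm_of_mem (mem_spectrum_of_isRoot_charpoly hroot)

theorem Matrix.card_roots_charpoly (A : Matrix n n ℂ) :
    A.charpoly.roots.card = Fintype.card n := by
  rw [IsAlgClosed.card_roots_eq_natDegree, charpoly_natDegree_eq_dim]

/-- Eigenvalues of $1+X$ are $1$ plus eigenvalues of $X$, which are bounded by the operator norm. -/
theorem Matrix.norm_det_one_add_bounds (X : Matrix n n ℂ) {η : ℝ} (hX : ‖X‖ ≤ η) (hη : η ≤ 1) :
    (1 - η) ^ Fintype.card n ≤ ‖(1 + X).det‖ ∧ ‖(1 + X).det‖ ≤ (1 + η) ^ Fintype.card n := by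
  rw [det_eq_prod_roots_charpoly, ← card_roots_charpoly (1 + X)]
  refine Multiset.norm_prod_bounds (by linarith) _ fun r hr => ?_
  have hroot := Polynomial.isRoot_of_mem_roots hr
  have h1 : ‖r - 1‖ ≤ η := by
    rcases isEmpty_or_nonempty n with h | h
    · simp [Matrix.charpoly] at hr
    · refine (spectrum.norm_le_norm_of_mem (a := X) (𝕜 := ℂ) ?_).trans hX
      have := mem_spectrum_of_isRoot_charpoly hroot
      rw [spectrum.mem_iff] at this ⊢
      convert this using 2
      simp only [map_sub, map_one]
      abel
  constructor
  · have := norm_sub_norm_le (1 : ℂ) (1 - r)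
    rw [norm_sub_rev, norm_one, sub_sub_cancel] at this
    linarith
  · have := norm_add_le (1 : ℂ) (r - 1)
    rw [norm_one, add_sub_cancel] at this
    linarith

theorem Matrix.norm_entry_le_l2_opNorm (A : Matrix n n ℂ) (i j : n) : ‖A i j‖ ≤ ‖A‖ := by
  have h := A.l2_opNorm_mulVec (EuclideanSpace.single j 1)
  simp only [PiLp.norm_single, norm_one, mul_one] at h
  refine le_trans ?_ h
  have := PiLp.norm_apply_le ((EuclideanSpace.equiv n ℂ).symm (A *ᵥ (EuclideanSpace.single j 1))) i
  simpa using this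

/-- Write $A=(1+G)B$ with $G=(A-B)B^{-1}$. The rows of $G$ outside $S$ vanish, so $G=UV$ factors
through $\mathbb C^S$ and $\det(1+UV)=\det(1+VU)$ is of size $|S|$. The Leibniz expansion bounds it
from the entries of $B^{-1}$ alone. -/
theorem Matrix.norm_det_le_of_rows {A B : Matrix n n ℂ} (S : Finset n)
    (hAB : ∀ i ∉ S, ∀ j, A i j = B i j) (hB : B.det ≠ 0) {f b : ℝ}
    (hF : ∀ i j, ‖(A - B) i j‖ ≤ f) (hb : ∀ i j, ‖B⁻¹ i j‖ ≤ b) :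
    ‖A.det‖ ≤ ‖B.det‖ * (S.card.factorial * (1 + Fintype.card n * (f * b)) ^ S.card) := by
  set G := (A - B) * B⁻¹ with hG
  have hBu : IsUnit B.det := isUnit_iff_ne_zero.mpr hB
  let U : Matrix n S ℂ := (1 : Matrix n n ℂ).submatrix id (↑)
  let V : Matrix S n ℂ := G.submatrix (↑) id
  have hUV : U * V = G := by
    ext i j
    simp only [U, V, mul_apply, submatrix_apply, id, one_apply, ite_mul, one_mul, zero_mul]
    by_cases hi : i ∈ S
    · rw [Finset.sum_eq_single ⟨i, hi⟩] <;> simp +contextual [Subtype.ext_iff, eq_comm]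
    · rw [Finset.sum_eq_zero]
      · rw [hG, mul_apply, Finset.sum_eq_zero]
        intro k _
        simp [hAB i hi k]
      · intro k _
        rw [if_neg]
        rintro rfl
        exact hi k.2
  have hVU : V * U = G.submatrix (↑) (↑) := by
    ext i j
    simp [U, V, mul_apply, one_apply]
  have hA : A = (1 + G) * B := by
    rw [add_mul, one_mul, hG, mul_assoc, nonsing_inv_mul _ hBu, mul_one]
    abel
  have hGe : ∀ i j, ‖G i j‖ ≤ Fintype.card n * (f * b) := by
    intro i j
    rw [hG, mul_apply]
    refine (norm_sum_le _ _).trans ?_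
    rw [← nsmul_eq_mul, ← Finset.card_univ, ← Finset.sum_const]
    refine Finset.sum_le_sum fun k _ => ?_
    rw [norm_mul]
    exact mul_le_mul (hF i k) (hb k j) (norm_nonneg _) ((norm_nonneg _).trans (hF i k))
  have hdet : A.det = (1 + V * U).det * B.det := by
    rw [← det_one_add_mul_comm, hUV, ← det_mul, ← hA]
  rw [hdet, norm_mul, mul_comm]
  gcongr
  have := det_le (A := 1 + V * U) (abv := NormedField.toAbsoluteValue ℂ)
    (x := 1 + Fintype.card n * (f * b)) (by
      intro i j
      rw [hVU, add_apply]
      refine (norm_add_le _ _).trans (add_le_add ?_ (hGe _ _))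
      rw [one_apply]
      split_ifs <;> simp)
  rw [nsmul_eq_mul, Fintype.card_coe] at this
  exact this

end Determinants

/-! ### Toeplitz and circulant matrices of a symbol -/

section ToeplitzAndCirculant

open Matrix
open scoped Matrix.Norms.L2Operator

/-- By the $C^*$-identity: $J^*J$ is diagonal with entries $0$ or $1$. -/
theorem norm_diagonalBand_le (N : ℕ) (ν : ℤ) :
    ‖(Matrix.of fun j k : Fin N => if (j : ℤ) - k = ν then (1 : ℂ) else 0)‖ ≤ 1 := by
  set J : Matrix (Fin N) (Fin N) ℂ :=
    Matrix.of fun j k : Fin N => if (j : ℤ) - k = ν then (1 : ℂ) else 0 with hJ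
  have h : Jᴴ * J = diagonal fun k : Fin N => ∑ j : Fin N, if (j : ℤ) - k = ν then (1 : ℂ) else 0 := by
    ext k l
    rw [mul_apply, diagonal_apply]
    split_ifs with hkl
    · subst hkl
      refine Finset.sum_congr rfl fun j _ => ?_
      simp [hJ, conjTranspose_apply]
    · refine Finset.sum_eq_zero fun j _ => ?_
      simp only [hJ, conjTranspose_apply, of_apply]
      by_cases h1 : (j : ℤ) - k = ν
      · have : (j : ℤ) - l ≠ ν := fun h2 => hkl (Fin.ext (by omega))
        simp [this]
      · simp [h1]
  have h2 : ‖J‖ * ‖J‖ ≤ 1 := by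
    rw [← l2_opNorm_conjTranspose_mul_self, h, l2_opNorm_diagonal]
    refine (pi_norm_le_iff_of_nonneg zero_le_one).2 fun k => ?_
    rw [← Finset.sum_filter, Finset.sum_const, nsmul_eq_mul, mul_one, Complex.norm_natCast]
    have : (Finset.univ.filter fun j : Fin N => (j : ℤ) - k = ν).card ≤ 1 :=
      Finset.card_le_one.2 fun x hx y hy => by
        simp only [Finset.mem_filter, Finset.mem_univ, true_and] at hx hy
        exact Fin.ext (by omega)
    exact_mod_cast this
  nlinarith [norm_nonneg J]

theorem norm_toeplitzMatrix_le {f : ℤ → ℂ} (hf : Summable fun ν => ‖f ν‖) (N : ℕ) :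
    ‖toeplitzMatrix f N‖ ≤ ∑' ν, ‖f ν‖ := by
  have h : toeplitzMatrix f N = ∑ ν ∈ Finset.Ioo (-(N : ℤ)) N,
      f ν • (Matrix.of fun j k : Fin N => if (j : ℤ) - k = ν then (1 : ℂ) else 0) := by
    ext j k
    rw [Matrix.sum_apply, Finset.sum_eq_single ((j : ℤ) - k)]
    · simp [toeplitzMatrix]
    · intro ν _ hν
      simp [Ne.symm hν]
    · intro h
      have := j.2
      have := k.2
      simp only [Finset.mem_Ioo, not_and_or, not_lt] at h
      omega
  rw [h]
  refine (norm_sum_le _ _).trans (le_trans (Finset.sum_le_sum fun ν _ => ?_)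
    (hf.sum_le_tsum _ fun _ _ => norm_nonneg _))
  rw [norm_smul]
  exact mul_le_of_le_one_right (norm_nonneg _) (norm_diagonalBand_le N ν)

theorem norm_toeplitzSymbol_le {f : ℤ → ℂ} (hf : Summable fun ν => ‖f ν‖) (ζ : Circle) :
    ‖toeplitzSymbol f ζ‖ ≤ ∑' ν, ‖f ν‖ := by
  have h : ∀ ν, ‖f ν * (ζ : ℂ) ^ ν‖ = ‖f ν‖ := fun ν => by simp [Circle.norm_coe]
  refine (norm_tsum_le_tsum_norm ?_).trans_eq (tsum_congr h)
  simpa only [h] using hf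

theorem summable_toeplitzSymbol {f : ℤ → ℂ} (hf : Summable fun ν => ‖f ν‖) (ζ : Circle) :
    Summable fun ν => f ν * (ζ : ℂ) ^ ν :=
  Summable.of_norm (by simpa [Circle.norm_coe] using hf)

theorem continuous_toeplitzSymbol {f : ℤ → ℂ} (hf : Summable fun ν => ‖f ν‖) :
    Continuous (toeplitzSymbol f) := by
  refine continuous_tsum (fun ν => ?_) hf fun ν ζ => by simp [Circle.norm_coe]
  exact continuous_const.mul (continuous_subtype_val.zpow₀ ν fun ζ => Or.inl (Circle.coe_ne_zero ζ))

/-- The `N`-th roots of unity `e^{2πil/N}` as points of the circle. -/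
noncomputable def unityNode (N : ℕ) (l : Fin N) : Circle := Circle.exp (2 * π * ((l : ℝ) / N))

theorem sum_unityNode_zpow {N : ℕ} (hN : N ≠ 0) (m : ℤ) :
    ∑ l, (unityNode N l : ℂ) ^ m = if (N : ℤ) ∣ m then (N : ℂ) else 0 := by
  have hN' : (N : ℂ) ≠ 0 := by exact_mod_cast hN
  set w : ℂ := Complex.exp (2 * π * Complex.I / N) with hw
  have hprim : IsPrimitiveRoot w N := Complex.isPrimitiveRoot_exp N hN
  have h1 : ∀ l : Fin N, (unityNode N l : ℂ) ^ m = (w ^ m) ^ (l : ℕ) := by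
    intro l
    have : (unityNode N l : ℂ) = w ^ (l : ℕ) := by
      rw [unityNode, Circle.coe_exp, hw, ← Complex.exp_nat_mul]
      congr 1
      push_cast
      field_simp
    rw [this, ← zpow_natCast, ← zpow_natCast, ← _root_.zpow_mul, ← _root_.zpow_mul, mul_comm]
  simp_rw [h1]
  rw [Fin.sum_univ_eq_sum_range (fun l => (w ^ m) ^ l) N]
  split_ifs with h
  · rw [(hprim.zpow_eq_one_iff_dvd m).2 h]
    simp
  · have hne : w ^ m ≠ 1 := fun h' => h ((hprim.zpow_eq_one_iff_dvd m).1 h')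
    rw [geom_sum_eq hne]
    have : (w ^ m) ^ N = 1 := by
      rw [← zpow_natCast, ← _root_.zpow_mul, mul_comm, _root_.zpow_mul, zpow_natCast, hprim.pow_eq_one, _root_.one_zpow]
    rw [this, sub_self, zero_div]

/-- The unitary discrete Fourier matrix. -/
noncomputable def fourierMatrix (N : ℕ) : Matrix (Fin N) (Fin N) ℂ :=
  Matrix.of fun j l => ((√N : ℝ) : ℂ)⁻¹ * (unityNode N l : ℂ) ^ (-(j : ℤ))

/-- The $(j,k)$ entry is the discrete Fourier coefficient of index $j-k$, the same indexing as for
the Toeplitz matrix. -/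
theorem fourierMatrix_mul_diagonal_mul_apply (N : ℕ) (D : Fin N → ℂ) (j k : Fin N) :
    (fourierMatrix N * diagonal D * (fourierMatrix N)ᴴ) j k =
      (N : ℂ)⁻¹ * ∑ l, D l * (unityNode N l : ℂ) ^ ((k : ℤ) - j) := by
  rw [mul_apply, Finset.mul_sum]
  refine Finset.sum_congr rfl fun l _ => ?_
  have hs : ((√N : ℝ) : ℂ)⁻¹ * ((√N : ℝ) : ℂ)⁻¹ = (N : ℂ)⁻¹ := by
    rw [← mul_inv, ← Complex.ofReal_mul, Real.mul_self_sqrt (Nat.cast_nonneg N)]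
    simp
  rw [mul_diagonal, conjTranspose_apply]
  simp only [fourierMatrix, of_apply, star_mul', star_inv₀, RCLike.star_def, Complex.conj_ofReal,
    map_zpow₀, ← Circle.coe_inv_eq_conj, Circle.coe_inv]
  rw [_root_.inv_zpow, _root_.zpow_neg (_ : ℂ) (k : ℤ), inv_inv, sub_eq_add_neg,
    zpow_add₀ (Circle.coe_ne_zero _), ← hs]
  ring

theorem fourierMatrix_mul_conjTranspose {N : ℕ} (hN : N ≠ 0) :
    fourierMatrix N * (fourierMatrix N)ᴴ = 1 := by
  have hN' : (N : ℂ) ≠ 0 := by exact_mod_cast hN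
  have h : fourierMatrix N * (fourierMatrix N)ᴴ =
      fourierMatrix N * diagonal (fun _ => 1) * (fourierMatrix N)ᴴ := by
    rw [diagonal_one, mul_one]
  ext j k
  rw [h, fourierMatrix_mul_diagonal_mul_apply]
  simp only [one_mul]
  rw [sum_unityNode_zpow hN, one_apply]
  have hjk : (N : ℤ) ∣ (k : ℤ) - j ↔ j = k := by
    constructor
    · intro h
      have := Int.eq_zero_of_abs_lt_dvd h (by rw [abs_lt]; omega)
      exact Fin.ext (by omega)
    · rintro rfl
      simp
  simp only [hjk]
  split_ifs
  · field_simp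
  · simp

/-- The circulant matrix whose eigenvalues are the values of `g` at the `N`-th roots of unity. -/
noncomputable def circulantOf (g : Circle → ℂ) (N : ℕ) : Matrix (Fin N) (Fin N) ℂ :=
  fourierMatrix N * diagonal (fun l => g (unityNode N l)) * (fourierMatrix N)ᴴ

theorem det_circulantOf (g : Circle → ℂ) {N : ℕ} (hN : N ≠ 0) :
    (circulantOf g N).det = ∏ l, g (unityNode N l) := by
  rw [circulantOf, det_mul_right_comm, fourierMatrix_mul_conjTranspose hN, one_mul, det_diagonal]

theorem circulantOf_mul (g h : Circle → ℂ) {N : ℕ} (hN : N ≠ 0) :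
    circulantOf g N * circulantOf h N = circulantOf (g * h) N := by
  have h1 : (fourierMatrix N)ᴴ * fourierMatrix N = 1 :=
    mul_eq_one_comm.1 (fourierMatrix_mul_conjTranspose hN)
  have h2 : circulantOf g N * circulantOf h N = fourierMatrix N *
      (diagonal (fun l => g (unityNode N l)) * ((fourierMatrix N)ᴴ * fourierMatrix N) *
        diagonal (fun l => h (unityNode N l))) * (fourierMatrix N)ᴴ := by
    simp only [circulantOf, mul_assoc]
  rw [h2, h1, mul_one, diagonal_mul_diagonal]
  rfl

theorem circulantOf_one {N : ℕ} (hN : N ≠ 0) : circulantOf 1 N = 1 := by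
  have : (diagonal fun l => (1 : Circle → ℂ) (unityNode N l)) = (1 : Matrix (Fin N) (Fin N) ℂ) :=
    diagonal_one
  rw [circulantOf, this, mul_one, fourierMatrix_mul_conjTranspose hN]

theorem circulantOf_sub (g h : Circle → ℂ) (N : ℕ) :
    circulantOf (g - h) N = circulantOf g N - circulantOf h N := by
  have : (diagonal fun l => (g - h) (unityNode N l)) =
      (diagonal (fun l => g (unityNode N l)) - diagonal fun l => h (unityNode N l) :
        Matrix (Fin N) (Fin N) ℂ) := by
    rw [diagonal_sub]
    rfl
  rw [circulantOf, this, mul_sub, sub_mul]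
  rfl

theorem norm_circulantOf_le {g : Circle → ℂ} {M : ℝ} (hg : ∀ ζ, ‖g ζ‖ ≤ M) {N : ℕ} (hN : N ≠ 0) :
    ‖circulantOf g N‖ ≤ M := by
  have hM : 0 ≤ M := (norm_nonneg _).trans (hg 1)
  have : NeZero N := ⟨hN⟩
  have hU : ‖fourierMatrix N‖ = 1 := CStarRing.norm_of_mem_unitary
    (Matrix.mem_unitaryGroup_iff.2 (fourierMatrix_mul_conjTranspose hN))
  have hD : ‖(diagonal fun l => g (unityNode N l) : Matrix (Fin N) (Fin N) ℂ)‖ ≤ M := by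
    rw [l2_opNorm_diagonal]
    exact (pi_norm_le_iff_of_nonneg hM).2 fun l => hg _
  rw [circulantOf]
  refine (l2_opNorm_mul _ _).trans ?_
  rw [l2_opNorm_conjTranspose, hU, mul_one]
  refine (l2_opNorm_mul _ _).trans ?_
  rwa [hU, one_mul]

/-- Away from the first and last `d` rows, the circulant and the Toeplitz matrices of a symbol with
frequencies in `[-d, d]` agree. -/
theorem circulantOf_apply_eq_toeplitzMatrix {q : ℤ → ℂ} {d N : ℕ}
    (hq : ∀ ν, ν ∉ Finset.Icc (-(d : ℤ)) d → q ν = 0) (j k : Fin N) (hj : d ≤ (j : ℕ))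
    (hj' : (j : ℕ) + d < N) :
    circulantOf (toeplitzSymbol q) N j k = toeplitzMatrix q N j k := by
  have hN : N ≠ 0 := by omega
  have hN' : (N : ℂ) ≠ 0 := by exact_mod_cast hN
  rw [circulantOf, fourierMatrix_mul_diagonal_mul_apply]
  have h1 : ∀ ζ : Circle, toeplitzSymbol q ζ * (ζ : ℂ) ^ ((k : ℤ) - j) =
      ∑ ν ∈ Finset.Icc (-(d : ℤ)) d, q ν * (ζ : ℂ) ^ (ν + (k - j)) := by
    intro ζ
    rw [toeplitzSymbol, tsum_eq_sum (s := Finset.Icc (-(d : ℤ)) d)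
      (fun ν hν => by rw [hq ν hν, zero_mul]), Finset.sum_mul]
    refine Finset.sum_congr rfl fun ν _ => ?_
    rw [zpow_add₀ ζ.coe_ne_zero, mul_assoc]
  simp_rw [h1]
  rw [Finset.sum_comm]
  simp_rw [← Finset.mul_sum, sum_unityNode_zpow hN]
  have h2 : ∀ ν ∈ Finset.Icc (-(d : ℤ)) d,
      q ν * (if (N : ℤ) ∣ ν + (k - j) then (N : ℂ) else 0) =
        if ν = (j : ℤ) - k then q ν * N else 0 := by
    intro ν hν
    rw [Finset.mem_Icc] at hν
    -- No wrap-around: $d\le j<N-d$ and $|\nu|\le d$ force $|\nu+k-j|<N$, so the only multiple of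
    -- $N$ available is $0$.
    have : (N : ℤ) ∣ ν + (k - j) ↔ ν = (j : ℤ) - k := by
      constructor
      · intro h
        have := Int.eq_zero_of_abs_lt_dvd h (by rw [abs_lt]; omega)
        omega
      · rintro rfl
        simp
    simp only [this]
    split_ifs <;> simp
  rw [Finset.sum_congr rfl h2, Finset.sum_ite_eq']
  split_ifs with h
  · rw [toeplitzMatrix, of_apply]
    field_simp
  · rw [toeplitzMatrix, of_apply, hq _ h, mul_zero]

end ToeplitzAndCirculant

/-! ### Riemann sums over roots of unity -/

section RiemannSum

theorem tendsto_riemannSum {h : ℝ → ℝ} (hh : Continuous h) :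
    Tendsto (fun N : ℕ => (∑ l : Fin N, h ((l : ℝ) / N)) / N) atTop (𝓝 (∫ x in (0 : ℝ)..1, h x)) := by
  rw [Metric.tendsto_atTop]
  intro ε hε
  have huc : UniformContinuousOn h (Set.Icc 0 1) :=
    isCompact_Icc.uniformContinuousOn_of_continuous hh.continuousOn
  obtain ⟨δ, hδ, hδ'⟩ := Metric.uniformContinuousOn_iff.1 huc (ε / 2) (by positivity)
  obtain ⟨N₀, hN₀⟩ := exists_nat_gt (1 / δ)
  refine ⟨N₀ + 1, fun N hN => ?_⟩
  have hNpos : (0 : ℝ) < N := by exact_mod_cast (by omega : 0 < N)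
  have hNδ : 1 / (N : ℝ) < δ := by
    rw [div_lt_comm₀ hNpos hδ]
    refine hN₀.trans ?_
    exact_mod_cast (by omega : N₀ < N)
  have hsum : ∫ x in (0 : ℝ)..1, h x =
      ∑ l ∈ Finset.range N, ∫ x in ((l : ℝ) / N)..((l + 1 : ℕ) : ℝ) / N, h x := by
    rw [intervalIntegral.sum_integral_adjacent_intervals (a := fun l : ℕ => (l : ℝ) / N)
      fun k _ => hh.intervalIntegrable _ _]
    simp [hNpos.ne']
  have hsum' : (∑ l : Fin N, h ((l : ℝ) / N)) / N =
      ∑ l ∈ Finset.range N, ∫ x in ((l : ℝ) / N)..((l + 1 : ℕ) : ℝ) / N, h ((l : ℝ) / N) := by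
    rw [Fin.sum_univ_eq_sum_range (fun l => h ((l : ℝ) / N)) N, Finset.sum_div]
    refine Finset.sum_congr rfl fun l _ => ?_
    rw [intervalIntegral.integral_const, smul_eq_mul]
    push_cast
    field_simp
    ring
  rw [dist_comm, Real.dist_eq, hsum, hsum', ← Finset.sum_sub_distrib]
  have hbound : ∀ l ∈ Finset.range N,
      |(∫ x in ((l : ℝ) / N)..((l + 1 : ℕ) : ℝ) / N, h x) -
        ∫ x in ((l : ℝ) / N)..((l + 1 : ℕ) : ℝ) / N, h ((l : ℝ) / N)| ≤ ε / 2 * (1 / N) := by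
    intro l hl
    have hlN : ((l + 1 : ℕ) : ℝ) ≤ N := by exact_mod_cast Finset.mem_range.1 hl
    have hle : (l : ℝ) / N ≤ ((l + 1 : ℕ) : ℝ) / N := by
      gcongr
      simp
    rw [← intervalIntegral.integral_sub (hh.intervalIntegrable _ _) (by simp), ← Real.norm_eq_abs]
    refine (intervalIntegral.norm_integral_le_of_norm_le_const (C := ε / 2) ?_).trans_eq ?_
    · intro x hx
      rw [Set.uIoc_of_le hle] at hx
      have hx1 : x ≤ 1 := hx.2.trans ((div_le_one hNpos).2 hlN)
      have hx0 : 0 ≤ (l : ℝ) / N := by positivity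
      refine (hδ' x ⟨hx0.trans hx.1.le, hx1⟩ _ ⟨hx0, hx.1.le.trans hx1⟩ ?_).le
      rw [Real.dist_eq, abs_of_nonneg (by linarith [hx.1])]
      have : ((l + 1 : ℕ) : ℝ) / N = l / N + 1 / N := by push_cast; ring
      linarith [hx.2]
    · rw [abs_of_nonneg (by linarith)]
      push_cast
      ring
  calc _ ≤ ∑ l ∈ Finset.range N, ε / 2 * (1 / (N : ℝ)) :=
        (Finset.abs_sum_le_sum_abs _ _).trans (Finset.sum_le_sum hbound)
    _ = ε / 2 := by
        rw [Finset.sum_const, Finset.card_range, nsmul_eq_mul]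
        field_simp
    _ < ε := by linarith

theorem tendsto_average_unityNode {g : Circle → ℝ} (hg : Continuous g) :
    Tendsto (fun N : ℕ => (∑ l, g (unityNode N l)) / N) atTop
      (𝓝 ((2 * π)⁻¹ * ∫ θ in -π..π, g (Circle.exp θ))) := by
  have h := tendsto_riemannSum (h := fun x => g (Circle.exp (2 * π * x)))
    (hg.comp (Circle.exp.continuous.comp (continuous_const.mul continuous_id)))
  have hper : Function.Periodic (fun θ => g (Circle.exp θ)) (2 * π) := fun θ => by
    simp only [Circle.exp_add_two_pi]
  have h2 : ∫ θ in -π..π, g (Circle.exp θ) = ∫ θ in (0 : ℝ)..2 * π, g (Circle.exp θ) := by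
    have := hper.intervalIntegral_add_eq (-π) 0
    rwa [zero_add, two_mul, neg_add_cancel_left, ← two_mul] at this
  rw [intervalIntegral.integral_comp_mul_left (fun θ => g (Circle.exp θ)) (by positivity),
    smul_eq_mul, mul_zero, mul_one, ← h2] at h
  exact h

end RiemannSum

/-! ### Asymptotics of perturbed Toeplitz determinants -/

section ToeplitzDeterminant

open Matrix
open scoped Matrix.Norms.L2Operator

/-- Comparison of the determinant of a perturbed Toeplitz matrix with that of a circulant. -/
theorem abs_log_norm_det_sub_le {b q : ℤ → ℂ} {d N : ℕ} (hN : 2 * d < N)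
    (hb : Summable fun ν => ‖b ν‖) (hq : ∀ ν, ν ∉ Finset.Icc (-(d : ℤ)) d → q ν = 0)
    {c M η t : ℝ} (hc : 0 < c) (hpc : ∀ ζ, c ≤ ‖toeplitzSymbol b ζ‖) (hη : 0 < η) (hη' : η ≤ 1 / 2)
    (hbq : ∑' ν, ‖b ν - q ν‖ ≤ c * η / 4) (hM : ∑' ν, ‖q ν‖ ≤ M) (hM0 : 0 ≤ M)
    {E : Matrix (Fin N) (Fin N) ℂ} (hE : ‖E‖ ≤ c * η / 4) (ht : 1 ≤ t)
    (hdet : (toeplitzMatrix b N + E).det ≠ 0)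
    (hadj : ∀ i j, ‖(toeplitzMatrix b N + E).adjugate i j‖ ≤ t * ‖(toeplitzMatrix b N + E).det‖) :
    |Real.log ‖(toeplitzMatrix b N + E).det‖ - ∑ l, Real.log ‖toeplitzSymbol b (unityNode N l)‖| ≤
      2 * η * N + Real.log ((2 * d).factorial * (1 + N * (2 * M * (2 / c + t))) ^ (2 * d)) := by
  have hN0 : N ≠ 0 := by omega
  set A := toeplitzMatrix b N + E with hA
  set p := toeplitzSymbol b with hp
  have hpne : ∀ ζ, p ζ ≠ 0 := fun ζ => norm_pos_iff.1 (hc.trans_le (hpc ζ))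
  have hqs : Summable fun ν => ‖q ν‖ :=
    summable_of_ne_finset_zero (s := Finset.Icc (-(d : ℤ)) d) fun ν hν => by rw [hq ν hν, norm_zero]
  have hbqs : Summable fun ν => ‖(b - q) ν‖ :=
    Summable.of_nonneg_of_le (fun _ => norm_nonneg _) (fun ν => norm_sub_le _ _) (hb.add hqs)
  have hsub : toeplitzSymbol (b - q) = p - toeplitzSymbol q := by
    ext ζ
    simp only [hp, toeplitzSymbol, Pi.sub_apply, sub_mul]
    exact (summable_toeplitzSymbol hb ζ).tsum_sub (summable_toeplitzSymbol hqs ζ)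
  set C := circulantOf p N with hC
  set Ci := circulantOf p⁻¹ N with hCi
  have hpp : p * p⁻¹ = 1 := by
    ext ζ
    simp [hpne ζ]
  have hCCi : C * Ci = 1 := by rw [hC, hCi, circulantOf_mul _ _ hN0, hpp, circulantOf_one hN0]
  have hCi_norm : ‖Ci‖ ≤ c⁻¹ := norm_circulantOf_le (fun ζ => by
    rw [Pi.inv_apply, norm_inv]
    exact inv_anti₀ hc (hpc ζ)) hN0
  have hCdet : ‖C.det‖ = ∏ l, ‖p (unityNode N l)‖ := by rw [hC, det_circulantOf _ hN0, norm_prod]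
  -- $B=C+S$ is the circulant of $q$ plus the Toeplitz matrix of the tail $b-q$ plus $E$. It thus
  -- shares the tail and $E$ with $A$, and $A-B$ involves only the band part $q$.
  set S := toeplitzMatrix (b - q) N - circulantOf (toeplitzSymbol (b - q)) N + E with hS
  have hSn : ‖S‖ ≤ c * η := by
    have h1 := (norm_toeplitzMatrix_le hbqs N).trans hbq
    have h2 := norm_circulantOf_le (fun ζ => (norm_toeplitzSymbol_le hbqs ζ).trans hbq) hN0
    have h3 := norm_add_le (toeplitzMatrix (b - q) N - circulantOf (toeplitzSymbol (b - q)) N) E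
    have h4 := norm_sub_le (toeplitzMatrix (b - q) N) (circulantOf (toeplitzSymbol (b - q)) N)
    have : 0 < c * η := by positivity
    linarith
  set X := Ci * S with hX
  have hXn : ‖X‖ ≤ η := by
    refine (l2_opNorm_mul _ _).trans ?_
    calc ‖Ci‖ * ‖S‖ ≤ c⁻¹ * (c * η) := by gcongr
      _ = η := by field_simp
  set B := C + S with hB
  have hBC : B = C * (1 + X) := by rw [mul_add, mul_one, hX, ← mul_assoc, hCCi, one_mul]
  obtain ⟨hlow, hupp⟩ := norm_det_one_add_bounds X hXn (by linarith)
  rw [Fintype.card_fin] at hlow hupp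
  have hXdet : 0 < ‖(1 + X).det‖ := lt_of_lt_of_le (pow_pos (by linarith) _) hlow
  have hCdet_pos : 0 < ‖C.det‖ := by
    rw [hCdet]
    exact Finset.prod_pos fun l _ => norm_pos_iff.2 (hpne _)
  have hBdet : ‖B.det‖ = ‖C.det‖ * ‖(1 + X).det‖ := by rw [hBC, det_mul, norm_mul]
  have hBdet_pos : 0 < ‖B.det‖ := by rw [hBdet]; positivity
  have hXu : IsUnit (1 + X).det := isUnit_iff_ne_zero.2 (norm_pos_iff.1 hXdet)
  have hXinv : ‖(1 + X)⁻¹‖ ≤ 2 := by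
    have h1 : (1 + X)⁻¹ = 1 - X * (1 + X)⁻¹ := by
      have := mul_nonsing_inv _ hXu
      rw [add_mul, one_mul] at this
      exact eq_sub_of_add_eq this
    have : NeZero N := ⟨hN0⟩
    have h2 : ‖(1 + X)⁻¹‖ ≤ 1 + η * ‖(1 + X)⁻¹‖ := by
      calc ‖(1 + X)⁻¹‖ = ‖1 - X * (1 + X)⁻¹‖ := by rw [← h1]
        _ ≤ ‖(1 : Matrix (Fin N) (Fin N) ℂ)‖ + ‖X * (1 + X)⁻¹‖ := norm_sub_le _ _
        _ ≤ 1 + η * ‖(1 + X)⁻¹‖ := by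
          rw [norm_one]
          gcongr
          exact (l2_opNorm_mul _ _).trans (by gcongr)
    nlinarith [norm_nonneg (1 + X)⁻¹]
  have hBinv : ∀ i j, ‖B⁻¹ i j‖ ≤ 2 / c := by
    intro i j
    refine (norm_entry_le_l2_opNorm _ i j).trans ?_
    have : B⁻¹ = (1 + X)⁻¹ * Ci := by
      rw [hBC, Matrix.mul_inv_rev, inv_eq_right_inv hCCi]
    rw [this]
    calc _ ≤ ‖(1 + X)⁻¹‖ * ‖Ci‖ := l2_opNorm_mul _ _
      _ ≤ 2 * c⁻¹ := by gcongr
      _ = 2 / c := by ring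
  have hAinv : ∀ i j, ‖A⁻¹ i j‖ ≤ t := by
    intro i j
    have : 0 < ‖A.det‖ := norm_pos_iff.2 hdet
    rw [inv_def, Matrix.smul_apply, Ring.inverse_eq_inv', smul_eq_mul, norm_mul, norm_inv]
    calc _ ≤ ‖A.det‖⁻¹ * (t * ‖A.det‖) := by gcongr; exact hadj i j
      _ = t := by field_simp
  have hF : A - B = toeplitzMatrix q N - circulantOf (toeplitzSymbol q) N := by
    have h1 : toeplitzMatrix (b - q) N = toeplitzMatrix b N - toeplitzMatrix q N := by
      ext i j
      rfl
    rw [hA, hB, hS, hC, hsub, circulantOf_sub, h1]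
    abel
  have hFn : ∀ i j, ‖(A - B) i j‖ ≤ 2 * M := by
    intro i j
    refine (norm_entry_le_l2_opNorm _ i j).trans ?_
    rw [hF]
    have h1 := (norm_toeplitzMatrix_le hqs N).trans hM
    have h2 := norm_circulantOf_le (fun ζ => (norm_toeplitzSymbol_le hqs ζ).trans hM) hN0
    linarith [norm_sub_le (toeplitzMatrix q N) (circulantOf (toeplitzSymbol q) N)]
  -- The rows in which the circulant wraps around: the first and last $d$.
  set R : Finset (Fin N) := Finset.univ.filter fun j => (j : ℕ) < d ∨ N ≤ (j : ℕ) + d with hR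
  have hRcard : R.card ≤ 2 * d := by
    have h1 : R.card = (R.map Fin.valEmbedding).card := (Finset.card_map _).symm
    have h2 : R.map Fin.valEmbedding ⊆ Finset.range d ∪ Finset.Ico (N - d) N := by
      intro x hx
      simp only [hR, Finset.mem_map, Finset.mem_filter, Finset.mem_univ, true_and,
        Fin.valEmbedding_apply] at hx
      obtain ⟨j, hj, rfl⟩ := hx
      have := j.2
      simp only [Finset.mem_union, Finset.mem_range, Finset.mem_Ico]
      omega
    rw [h1]
    refine (Finset.card_le_card h2).trans ((Finset.card_union_le _ _).trans ?_)
    simp only [Finset.card_range, Nat.card_Ico]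
    omega
  have hrow : ∀ i ∉ R, ∀ j, A i j = B i j := by
    intro i hi j
    simp only [hR, Finset.mem_filter, Finset.mem_univ, true_and, not_or, not_lt, not_le] at hi
    have h1 : (A - B) i j = 0 := by
      rw [hF, Matrix.sub_apply, circulantOf_apply_eq_toeplitzMatrix hq i j hi.1 hi.2, sub_self]
    rwa [Matrix.sub_apply, sub_eq_zero] at h1
  set K : ℝ := (2 * d).factorial * (1 + N * (2 * M * (2 / c + t))) ^ (2 * d) with hK
  have hbase : ∀ x, 0 ≤ x → x ≤ 2 / c + t →
      (R.card.factorial : ℝ) * (1 + Fintype.card (Fin N) * (2 * M * x)) ^ R.card ≤ K := by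
    intro x hx0 hx
    rw [Fintype.card_fin, hK]
    have h1 : (R.card.factorial : ℝ) ≤ (2 * d).factorial := by
      exact_mod_cast Nat.factorial_le hRcard
    have h2 : 1 + N * (2 * M * x) ≤ 1 + N * (2 * M * (2 / c + t)) := by gcongr
    have h0 : 0 ≤ (N : ℝ) * (2 * M * x) := by positivity
    calc _ ≤ ((2 * d).factorial : ℝ) * (1 + N * (2 * M * (2 / c + t))) ^ R.card := by gcongr
      _ ≤ _ := by
        gcongr
        linarith
  have hK1 : 1 ≤ K := by
    rw [hK]
    have h1 : (1 : ℝ) ≤ (2 * d).factorial := by exact_mod_cast Nat.one_le_iff_ne_zero.2 (Nat.factorial_ne_zero _)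
    have h2 : (1 : ℝ) ≤ (1 + N * (2 * M * (2 / c + t))) ^ (2 * d) :=
      one_le_pow₀ (by
        have : 0 ≤ (N : ℝ) * (2 * M * (2 / c + t)) := by positivity
        linarith)
    nlinarith
  have hc2 : 0 < 2 / c := by positivity
  -- The row comparison is used in both directions, with $\|B^{-1}\|\le 2/c$ here and the assumed
  -- cofactor bound on $A^{-1}$ in `hBA`.
  have hAB : ‖A.det‖ ≤ ‖B.det‖ * K :=
    (norm_det_le_of_rows R hrow (norm_pos_iff.1 hBdet_pos) hFn hBinv).trans (by
      gcongr
      exact hbase _ hc2.le (by linarith))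
  have hBA : ‖B.det‖ ≤ ‖A.det‖ * K :=
    (norm_det_le_of_rows R (fun i hi j => (hrow i hi j).symm) hdet
      (fun i j => by
        rw [← neg_sub A B, Matrix.neg_apply, norm_neg]
        exact hFn i j) hAinv).trans (by
      gcongr
      exact hbase _ (by linarith) (by linarith))
  have hApos : 0 < ‖A.det‖ := norm_pos_iff.2 hdet
  have hlogC : ∑ l, Real.log ‖p (unityNode N l)‖ = Real.log ‖C.det‖ := by
    rw [hCdet, Real.log_prod fun l _ => (norm_pos_iff.2 (hpne _)).ne']
  have hlogB : Real.log ‖B.det‖ = Real.log ‖C.det‖ + Real.log ‖(1 + X).det‖ := by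
    rw [hBdet, Real.log_mul hCdet_pos.ne' hXdet.ne']
  have hlogX1 : Real.log ‖(1 + X).det‖ ≤ 2 * η * N := by
    have h1 := Real.log_le_log hXdet hupp
    rw [Real.log_pow] at h1
    have h2 := Real.log_le_sub_one_of_pos (by linarith : 0 < 1 + η)
    have : (N : ℝ) * Real.log (1 + η) ≤ N * (2 * η) := by gcongr; linarith
    linarith
  have hlogX2 : -(2 * η * N) ≤ Real.log ‖(1 + X).det‖ := by
    have h1 := Real.log_le_log (pow_pos (by linarith) _) hlow
    rw [Real.log_pow] at h1
    have h2 := Real.one_sub_inv_le_log_of_pos (by linarith : 0 < 1 - η)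
    -- This is where $\eta\le 1/2$ is needed.
    have h3 : (1 - η)⁻¹ ≤ 1 + 2 * η := by
      rw [inv_le_iff_one_le_mul₀ (by linarith)]
      nlinarith
    have : (N : ℝ) * (-(2 * η)) ≤ N * Real.log (1 - η) := by gcongr; linarith
    linarith
  have h1 := Real.log_le_log hApos hAB
  have h2 := Real.log_le_log hBdet_pos hBA
  rw [Real.log_mul hBdet_pos.ne' (by linarith)] at h1
  rw [Real.log_mul hApos.ne' (by linarith)] at h2
  rw [hlogC, abs_le]
  constructor <;> linarith

/-- The truncation degree $d$ depends on the target accuracy but not on $N$. The $2d$ exceptional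
rows therefore contribute only $O(d\log(N t_N))$, which is $o(N)$. -/
theorem tendsto_log_norm_det {b : ℤ → ℂ} (hb : Summable fun ν => ‖b ν‖)
    (hne : ∀ ζ, toeplitzSymbol b ζ ≠ 0) {E : ∀ N : ℕ, Matrix (Fin N) (Fin N) ℂ}
    (hE : Tendsto (fun N => ‖E N‖) atTop (𝓝 0)) {t : ℕ → ℝ}
    (ht : Tendsto (fun N => Real.log (t N) / N) atTop (𝓝 0)) (ht1 : ∀ᶠ N in atTop, 1 ≤ t N)
    (hdet : ∀ᶠ N in atTop, (toeplitzMatrix b N + E N).det ≠ 0)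
    (hadj : ∀ᶠ N in atTop, ∀ i j, ‖(toeplitzMatrix b N + E N).adjugate i j‖ ≤
      t N * ‖(toeplitzMatrix b N + E N).det‖) :
    Tendsto (fun N : ℕ => Real.log ‖(toeplitzMatrix b N + E N).det‖ / N) atTop
      (𝓝 ((2 * π)⁻¹ * ∫ θ in -π..π, Real.log ‖toeplitzSymbol b (Circle.exp θ)‖)) := by
  have hcont := continuous_toeplitzSymbol hb
  obtain ⟨ζ₀, -, hζ₀⟩ := isCompact_univ.exists_isMinOn (Set.univ_nonempty (α := Circle))
    hcont.norm.continuousOn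
  set c := ‖toeplitzSymbol b ζ₀‖ with hc_def
  have hc : 0 < c := norm_pos_iff.2 (hne ζ₀)
  have hpc : ∀ ζ, c ≤ ‖toeplitzSymbol b ζ‖ := fun ζ => hζ₀ (Set.mem_univ ζ)
  have havg := tendsto_average_unityNode (g := fun ζ => Real.log ‖toeplitzSymbol b ζ‖)
    (hcont.norm.log fun ζ => (norm_pos_iff.2 (hne ζ)).ne')
  set M := ∑' ν, ‖b ν‖ with hM
  have hM0 : 0 ≤ M := tsum_nonneg fun _ => norm_nonneg _
  suffices h : Tendsto (fun N : ℕ => Real.log ‖(toeplitzMatrix b N + E N).det‖ / N -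
      (∑ l, Real.log ‖toeplitzSymbol b (unityNode N l)‖) / N) atTop (𝓝 0) by
    simpa using h.add havg
  rw [Metric.tendsto_nhds]
  intro ε hε
  -- The norm-small part then costs $2\eta\le\varepsilon/4$ per dimension, and the row correction is
  -- eventually below $\varepsilon/2$.
  set η := min (1 / 2) (ε / 8) with hη_def
  have hη : 0 < η := by positivity
  have hη1 : η ≤ 1 / 2 := min_le_left _ _
  have hη2 : η ≤ ε / 8 := min_le_right _ _
  obtain ⟨d, hd⟩ : ∃ d : ℕ, ∑' ν, ‖b ν - (if ν ∈ Finset.Icc (-(d : ℤ)) d then b ν else 0)‖ ≤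
      c * η / 4 := by
    have hcη : 0 < c * η / 4 := by positivity
    have h1 := (tendsto_tsum_compl_atTop_zero fun ν => ‖b ν‖).eventually (gt_mem_nhds hcη)
    obtain ⟨s, hs⟩ := eventually_atTop.1 h1
    obtain ⟨d, hd⟩ : ∃ d : ℕ, s ⊆ Finset.Icc (-(d : ℤ)) d := by
      refine ⟨s.sup Int.natAbs, fun ν hν => ?_⟩
      have := Finset.le_sup (f := Int.natAbs) hν
      rw [Finset.mem_Icc]
      omega
    refine ⟨d, le_trans (le_of_eq ?_) (hs _ hd).le⟩
    refine Eq.trans ?_ (tsum_subtype {ν | ν ∉ Finset.Icc (-(d : ℤ)) d} fun ν => ‖b ν‖).symm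
    refine tsum_congr fun ν => ?_
    by_cases hν : ν ∈ Finset.Icc (-(d : ℤ)) d
    · rw [if_pos hν, Set.indicator_of_notMem (fun h : ν ∉ _ => h hν), sub_self, norm_zero]
    · rw [if_neg hν, Set.indicator_of_mem (show ν ∈ {ν | ν ∉ Finset.Icc (-(d : ℤ)) d} from hν),
        sub_zero]
  set q : ℤ → ℂ := fun ν => if ν ∈ Finset.Icc (-(d : ℤ)) d then b ν else 0 with hq
  have hqle : ∀ ν, ‖q ν‖ ≤ ‖b ν‖ := fun ν => by
    simp only [hq]
    split_ifs <;> simp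
  have hqM : ∑' ν, ‖q ν‖ ≤ M :=
    (Summable.of_nonneg_of_le (fun _ => norm_nonneg _) hqle hb).tsum_le_tsum hqle hb
  -- Chosen so that $1+2MN(2/c+t)\le\kappa Nt$ whenever $N,t\ge1$, which splits the logarithm into
  -- three terms.
  set κ : ℝ := 1 + 2 * M * (2 / c + 1) with hκ
  have hκ0 : 0 < κ := by positivity
  have hlim : Tendsto (fun N : ℕ => Real.log ((2 * d).factorial : ℝ) / N +
      (2 * d : ℕ) * (Real.log κ / N + Real.log N / N + Real.log (t N) / N)) atTop (𝓝 0) := by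
    have hlogN : Tendsto (fun N : ℕ => Real.log N / N) atTop (𝓝 0) := by
      have h := Real.isLittleO_log_id_atTop.tendsto_div_nhds_zero
      exact h.comp tendsto_natCast_atTop_atTop
    have := (tendsto_const_div_atTop_nhds_zero_nat (Real.log ((2 * d).factorial : ℝ))).add
      ((((tendsto_const_div_atTop_nhds_zero_nat (Real.log κ)).add hlogN).add ht).const_mul
        (((2 * d : ℕ) : ℝ)))
    simpa using this
  filter_upwards [hlim.eventually (gt_mem_nhds (by positivity : 0 < ε / 2)), ht1, hdet, hadj,
    hE.eventually (gt_mem_nhds (by positivity : 0 < c * η / 4)), eventually_gt_atTop (2 * d)]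
    with N hlimN ht1N hdetN hadjN hEN hNd
  have hN : (0 : ℝ) < N := by exact_mod_cast (by omega : 0 < N)
  have hN1 : (1 : ℝ) ≤ N := by exact_mod_cast (by omega : 1 ≤ N)
  have key := abs_log_norm_det_sub_le hNd hb (q := q) (fun ν hν => if_neg hν) hc hpc hη hη1 hd hqM
    hM0 hEN.le ht1N hdetN hadjN
  have hKlog : Real.log ((2 * d).factorial * (1 + N * (2 * M * (2 / c + t N))) ^ (2 * d)) ≤
      Real.log ((2 * d).factorial : ℝ) +
        (2 * d : ℕ) * (Real.log κ + Real.log N + Real.log (t N)) := by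
    have hpos : 0 < 1 + N * (2 * M * (2 / c + t N)) := by positivity
    rw [Real.log_mul (by positivity) (by positivity), Real.log_pow]
    gcongr
    rw [← Real.log_mul hκ0.ne' hN.ne', ← Real.log_mul (by positivity) (by positivity)]
    refine Real.log_le_log hpos ?_
    have hc2 : 0 < 2 / c := by positivity
    have e1 : 2 / c + t N ≤ (2 / c + 1) * t N := by nlinarith
    have e2 : 1 ≤ (N : ℝ) * t N := by nlinarith
    calc 1 + N * (2 * M * (2 / c + t N)) ≤ N * t N + N * (2 * M * ((2 / c + 1) * t N)) := by
          gcongr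
      _ = κ * N * t N := by rw [hκ]; ring
  rw [Real.dist_eq, sub_zero, ← sub_div, abs_div, abs_of_pos hN, div_lt_iff₀ hN]
  refine key.trans_lt ?_
  have h3 : Real.log ((2 * d).factorial : ℝ) +
        (2 * d : ℕ) * (Real.log κ + Real.log N + Real.log (t N)) =
      (Real.log ((2 * d).factorial : ℝ) / N +
      (2 * d : ℕ) * (Real.log κ / N + Real.log N / N + Real.log (t N) / N)) * N := by
    field_simp
  have h4 := mul_lt_mul_of_pos_right hlimN hN
  nlinarith

end ToeplitzDeterminant

/-! ### Logarithmic potentials and uniform integrability -/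

section LogPotential

open Metric

/-- The truncation of `z ↦ log |z|` to a disc. -/
noncomputable def truncLog (R : ℝ) : ℂ → ℝ := (closedBall 0 R).indicator fun z => Real.log ‖z‖

/-- In polar coordinates the singularity becomes $r\log r$, which is continuous on $[0,R]$. -/
theorem integrable_truncLog (R : ℝ) : Integrable (truncLog R) := by
  have h : truncLog R = fun z : ℂ => (Set.Iic R).indicator Real.log ‖z‖ := by
    ext z
    by_cases hz : ‖z‖ ≤ R
    · rw [truncLog, Set.indicator_of_mem (mem_closedBall_zero_iff.2 hz), Set.indicator_of_mem (Set.mem_Iic.2 hz)]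
    · rw [truncLog, Set.indicator_of_notMem (mt mem_closedBall_zero_iff.1 hz),
        Set.indicator_of_notMem (mt Set.mem_Iic.1 hz)]
  rw [h, integrable_fun_norm_addHaar volume]
  simp only [Complex.finrank_real_complex, Nat.add_one_sub_one, pow_one, smul_eq_mul]
  have h2 : ∀ y, y * (Set.Iic R).indicator Real.log y =
      (Set.Iic R).indicator (fun y => y * Real.log y) y := fun y => by
    simp [Set.indicator_apply]
  simp_rw [h2]
  rw [integrableOn_indicator_iff measurableSet_Iic, Set.inter_comm]
  refine IntegrableOn.mono_set (t := Set.Icc 0 R) ?_ fun y hy => ⟨(Set.mem_Ioi.1 hy.1).le, hy.2⟩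
  exact Real.continuous_mul_log.continuousOn.integrableOn_Icc

theorem norm_mul_log_le {C R R' h : ℝ} {z a : ℂ} (hC : |h| ≤ C) (ha : ‖a‖ ≤ R)
    (hz : R' < ‖z‖ → h = 0) : ‖h * Real.log ‖z - a‖‖ ≤ C * ‖truncLog (R + R') (z - a)‖ := by
  by_cases hzR : R' < ‖z‖
  · rw [hz hzR, zero_mul, norm_zero]
    exact mul_nonneg ((abs_nonneg _).trans hC) (norm_nonneg _)
  · have : z - a ∈ closedBall (0 : ℂ) (R + R') := by
      rw [mem_closedBall_zero_iff]
      linarith [norm_sub_le z a]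
    rw [truncLog, Set.indicator_of_mem this, norm_mul]
    exact mul_le_mul_of_nonneg_right hC (norm_nonneg _)

theorem integrable_mul_log {h : ℂ → ℝ} (hh : Measurable h) {C R R' : ℝ} (hC : ∀ z, |h z| ≤ C)
    (hz : ∀ z, R' < ‖z‖ → h z = 0) {a : ℂ} (ha : ‖a‖ ≤ R) :
    Integrable (fun z => h z * Real.log ‖z - a‖) :=
  Integrable.mono' (((integrable_truncLog (R + R')).comp_sub_right a).norm.const_mul C)
    (by fun_prop) (ae_of_all _ fun z => norm_mul_log_le (hC z) ha (hz z))

/-- Joint integrability of a bounded compactly supported density against a logarithmic kernel with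
a varying pole. -/
theorem integrable_prod_mul_log {X : Type*} [MeasurableSpace X] (ν : Measure X) [IsFiniteMeasure ν]
    {a : X → ℂ} (ha : Measurable a) {R : ℝ} (haR : ∀ᵐ x ∂ν, ‖a x‖ ≤ R) {h : X → ℂ → ℝ}
    (hh : Measurable (Function.uncurry h)) {C R' : ℝ} (hC : ∀ x z, |h x z| ≤ C)
    (hz : ∀ x z, R' < ‖z‖ → h x z = 0) :
    Integrable (fun p : X × ℂ => h p.1 p.2 * Real.log ‖p.2 - a p.1‖) (ν.prod volume) := by
  have hm : Measurable fun p : X × ℂ => h p.1 p.2 * Real.log ‖p.2 - a p.1‖ :=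
    Measurable.mul hh (by fun_prop)
  rw [integrable_prod_iff hm.aestronglyMeasurable]
  constructor
  · filter_upwards [haR] with x hx
    exact integrable_mul_log (by fun_prop) (hC x) (hz x) hx
  · refine Integrable.of_bound (C := C * ∫ z, ‖truncLog (R + R') z‖)
      hm.norm.aestronglyMeasurable.integral_prod_right' ?_
    filter_upwards [haR] with x hx
    rw [Real.norm_of_nonneg (by positivity), ←
      integral_sub_right_eq_self (fun z => ‖truncLog (R + R') z‖) (a x),
      ← integral_const_mul]
    refine integral_mono_of_nonneg (ae_of_all _ fun z => norm_nonneg _)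
      (((integrable_truncLog (R + R')).comp_sub_right (a x)).norm.const_mul C)
      (ae_of_all _ fun z => norm_mul_log_le (hC x z) hx (hz x z))

/-- The logarithmic potential of a measure in the plane. -/
noncomputable def logPotential (ν : Measure ℂ) (z : ℂ) : ℝ := ∫ w, Real.log ‖z - w‖ ∂ν

theorem stronglyMeasurable_logPotential (ν : Measure ℂ) [SFinite ν] :
    StronglyMeasurable (logPotential ν) := by
  have : Measurable fun p : ℂ × ℂ => Real.log ‖p.1 - p.2‖ := by fun_prop
  exact this.stronglyMeasurable.integral_prod_right

theorem integral_mul_logPotential (ν : Measure ℂ) [IsFiniteMeasure ν] {R : ℝ}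
    (hν : ∀ᵐ w ∂ν, ‖w‖ ≤ R) {g : ℂ → ℝ} (hg : Measurable g) {C R' : ℝ} (hC : ∀ z, |g z| ≤ C)
    (hz : ∀ z, R' < ‖z‖ → g z = 0) :
    ∫ z, g z * logPotential ν z = ∫ w, (∫ z, g z * Real.log ‖z - w‖) ∂ν := by
  have h := integrable_prod_mul_log ν measurable_id hν (h := fun _ z => g z) (by fun_prop)
    (fun _ => hC) (fun _ => hz)
  rw [integral_integral_swap (f := fun w z => g z * Real.log ‖z - w‖) h]
  simp only [logPotential, integral_const_mul]

/-- Potentials of probability measures in a fixed disc are equi-integrable on compact sets. -/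
theorem setLIntegral_logPotential_le (ν : Measure ℂ) [IsProbabilityMeasure ν] {R R' : ℝ}
    (hν : ∀ᵐ w ∂ν, ‖w‖ ≤ R) {A : Set ℂ} (hA : MeasurableSet A) (hAR : A ⊆ closedBall 0 R')
    {ε : ℝ≥0∞} (hε : ∀ w : ℂ, ∫⁻ z in (fun z => z + w) ⁻¹' A, ‖truncLog (R + R') z‖ₑ ≤ ε) :
    ∫⁻ z in A, ‖logPotential ν z‖ₑ ≤ ε := by
  calc ∫⁻ z in A, ‖logPotential ν z‖ₑ
      ≤ ∫⁻ z in A, ∫⁻ w, ‖Real.log ‖z - w‖‖ₑ ∂ν :=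
        lintegral_mono fun z => enorm_integral_le_lintegral_enorm _
    _ = ∫⁻ w, (∫⁻ z in A, ‖Real.log ‖z - w‖‖ₑ) ∂ν :=
        lintegral_lintegral_swap (f := fun z w => ‖Real.log ‖z - w‖‖ₑ)
          (by
            have : Measurable fun p : ℂ × ℂ => ‖Real.log ‖p.1 - p.2‖‖ₑ := by fun_prop
            exact this.aemeasurable)
    _ ≤ ∫⁻ w, ε ∂ν := by
        refine lintegral_mono_ae (hν.mono fun w hw => ?_)
        refine le_trans (le_of_eq ?_) (hε w)
        rw [← lintegral_indicator hA, ← lintegral_add_right_eq_self _ w,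
          ← lintegral_indicator (hA.preimage (by fun_prop))]
        refine lintegral_congr fun z => ?_
        by_cases hz : z + w ∈ A
        · have h1 := mem_closedBall_zero_iff.1 (hAR hz)
          have h2 : z ∈ closedBall (0 : ℂ) (R + R') := by
            rw [mem_closedBall_zero_iff]
            have := norm_sub_le (z + w) w
            rw [add_sub_cancel_right] at this
            linarith
          rw [Set.indicator_of_mem hz, Set.indicator_of_mem (show z ∈ (fun z => z + w) ⁻¹' A from hz), truncLog,
            Set.indicator_of_mem h2, add_sub_cancel_right]
        · rw [Set.indicator_of_notMem hz, Set.indicator_of_notMem (show z ∉ (fun z => z + w) ⁻¹' A from hz)]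
    _ = ε := by simp

/-- Translation invariance of Lebesgue measure makes a single $\delta$, from absolute continuity of
the integral of the truncated logarithm, serve every pole $w$ and hence every average over poles. -/
theorem exists_setLIntegral_logPotential_le (R R' : ℝ) {ε : ℝ≥0∞} (hε : ε ≠ 0) :
    ∃ δ > 0, ∀ (ν : Measure ℂ) [IsProbabilityMeasure ν], (∀ᵐ w ∂ν, ‖w‖ ≤ R) →
      ∀ A, MeasurableSet A → A ⊆ closedBall 0 R' → volume A < δ →
        ∫⁻ z in A, ‖logPotential ν z‖ₑ ≤ ε := by
  obtain ⟨δ, hδ, h⟩ := exists_pos_setLIntegral_lt_of_measure_lt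
    (integrable_truncLog (R + R')).2.ne hε
  refine ⟨δ, hδ, fun ν _ hν A hA hAR hvol => setLIntegral_logPotential_le ν hν hA hAR fun w => ?_⟩
  refine (h _ ?_).le
  rwa [measure_preimage_add_right]

theorem integrableOn_logPotential (ν : Measure ℂ) [IsProbabilityMeasure ν] {R R' : ℝ}
    (hν : ∀ᵐ w ∂ν, ‖w‖ ≤ R) : IntegrableOn (logPotential ν) (closedBall 0 R') := by
  refine ⟨(stronglyMeasurable_logPotential ν).aestronglyMeasurable, ?_⟩
  exact (setLIntegral_logPotential_le ν hν measurableSet_closedBall subset_rfl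
    fun w => setLIntegral_le_lintegral _ _).trans_lt (integrable_truncLog (R + R')).2

/-- Pointwise convergence and equi-integrability give $L^1$ convergence on a disc by Vitali's
theorem; a bounded density supported there preserves it. -/
theorem tendsto_integral_mul_logPotential {ξ : ℕ → Measure ℂ} [∀ N, IsProbabilityMeasure (ξ N)]
    {μ : Measure ℂ} [IsProbabilityMeasure μ] {R : ℝ} (hξ : ∀ N, ∀ᵐ w ∂ξ N, ‖w‖ ≤ R)
    (hμ : ∀ᵐ w ∂μ, ‖w‖ ≤ R)
    (hpot : ∀ᵐ z, Tendsto (fun N => logPotential (ξ N) z) atTop (𝓝 (logPotential μ z)))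
    {g : ℂ → ℝ} (hg : Measurable g) {C R' : ℝ} (hC : ∀ z, |g z| ≤ C)
    (hz : ∀ z, R' < ‖z‖ → g z = 0) :
    Tendsto (fun N => ∫ z, g z * logPotential (ξ N) z) atTop
      (𝓝 (∫ z, g z * logPotential μ z)) := by
  have : IsFiniteMeasure (volume.restrict (closedBall (0 : ℂ) R')) :=
    ⟨by rw [Measure.restrict_apply_univ]; exact measure_closedBall_lt_top⟩
  have hvit := tendsto_Lp_finite_of_tendsto_ae (μ := volume.restrict (closedBall (0 : ℂ) R'))
    le_rfl ENNReal.one_ne_top (f := fun N => logPotential (ξ N)) (g := logPotential μ)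
    (fun N => (stronglyMeasurable_logPotential _).aestronglyMeasurable)
    (memLp_one_iff_integrable.2 (integrableOn_logPotential μ hμ)) ?_ (ae_restrict_of_ae hpot)
  · have hset : ∀ ν : Measure ℂ, ∫ z, g z * logPotential ν z =
        ∫ z in closedBall 0 R', g z * logPotential ν z := fun ν => by
      refine (setIntegral_eq_integral_of_forall_compl_eq_zero fun z hz' => ?_).symm
      rw [hz z (by simpa using hz'), zero_mul]
    have hint : ∀ (ν : Measure ℂ) [IsProbabilityMeasure ν], (∀ᵐ w ∂ν, ‖w‖ ≤ R) →
        IntegrableOn (fun z => g z * logPotential ν z) (closedBall 0 R') := fun ν _ hν =>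
      (integrableOn_logPotential ν hν).bdd_mul hg.aestronglyMeasurable
        (ae_of_all _ fun z => by simpa using hC z)
    simp_rw [hset]
    refine tendsto_integral_of_L1' _ (hint μ hμ).1 (Eventually.of_forall fun N => hint _ (hξ N)) ?_
    have hlim : Tendsto (fun N => ENNReal.ofReal C * eLpNorm (logPotential (ξ N) - logPotential μ) 1
        (volume.restrict (closedBall 0 R'))) atTop (𝓝 0) := by
      have := ENNReal.Tendsto.const_mul hvit (Or.inr ENNReal.ofReal_ne_top) (a := ENNReal.ofReal C)
      rwa [mul_zero] at this
    refine tendsto_of_tendsto_of_tendsto_of_le_of_le tendsto_const_nhds hlim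
      (fun _ => zero_le) fun N => ?_
    have h1 := eLpNorm_le_mul_eLpNorm_of_ae_le_mul (p := 1)
      (μ := volume.restrict (closedBall (0 : ℂ) R'))
      (f := (fun z => g z * logPotential (ξ N) z) - fun z => g z * logPotential μ z)
      (g := logPotential (ξ N) - logPotential μ) (c := C) (ae_of_all _ fun z => by
        rw [Pi.sub_apply, Pi.sub_apply, ← mul_sub, norm_mul]
        exact mul_le_mul_of_nonneg_right (hC z) (norm_nonneg _))
    exact h1
  · intro ε hε
    obtain ⟨δ, hδ, h⟩ := exists_setLIntegral_logPotential_le R R'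
      (ε := ENNReal.ofReal ε) (by simpa using hε)
    -- The minimum with $1$ guards against $\delta=\infty$; halving turns the weak inequality on the
    -- measure of $s$ into a strict one.
    refine ⟨(min δ 1).toReal / 2, ?_, fun N s hs hsδ => ?_⟩
    · have : 0 < (min δ 1).toReal := ENNReal.toReal_pos (by positivity) (by simp)
      positivity
    · rw [eLpNorm_one_eq_lintegral_enorm]
      simp_rw [enorm_indicator_eq_indicator_enorm]
      rw [lintegral_indicator hs, Measure.restrict_restrict hs]
      refine h (ξ N) (hξ N) _ (hs.inter measurableSet_closedBall) Set.inter_subset_right ?_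
      rw [Measure.restrict_apply hs] at hsδ
      refine hsδ.trans_lt ?_
      have hpos : 0 < (min δ 1).toReal := ENNReal.toReal_pos (by positivity) (by simp)
      calc ENNReal.ofReal ((min δ 1).toReal / 2) < ENNReal.ofReal (min δ 1).toReal :=
            (ENNReal.ofReal_lt_ofReal_iff hpos).2 (by linarith)
        _ = min δ 1 := ENNReal.ofReal_toReal (by simp)
        _ ≤ δ := min_le_left _ _

/-- Averaging a test function over circles amounts to averaging the logarithmic kernel. -/
theorem integral_circleAverage_mul_log {f : ℂ → ℝ} (hf : Continuous f) {C R : ℝ}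
    (hC : ∀ z, |f z| ≤ C) (hz : ∀ z, R < ‖z‖ → f z = 0) {r : ℝ} (hr : 0 < r) (w : ℂ) :
    ∫ z, Real.circleAverage f z (-r) * Real.log ‖z - w‖ =
      ∫ c, f c * (Real.log r + Real.posLog (r⁻¹ * ‖c - w‖)) := by
  set ν : Measure ℝ := volume.restrict (Set.Ioc 0 (2 * π)) with hν
  have hcm : Continuous fun p : ℝ × ℂ => circleMap p.2 (-r) p.1 := by
    simp only [circleMap]
    fun_prop
  have h1 : Integrable (fun p : ℝ × ℂ => f (circleMap p.2 (-r) p.1) * Real.log ‖p.2 - w‖)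
      (ν.prod volume) := by
    refine integrable_prod_mul_log ν (a := fun _ => w) measurable_const
      (ae_of_all _ fun _ => le_rfl) (h := fun θ z => f (circleMap z (-r) θ))
      (hf.comp hcm).measurable (C := C) (R' := R + r) (fun _ _ => hC _) fun θ z hzz => hz _ ?_
    have h2 := norm_sub_le (circleMap z (-r) θ) (circleMap 0 (-r) θ)
    have h3 : circleMap z (-r) θ - circleMap 0 (-r) θ = z := by simp [circleMap]
    rw [h3, norm_circleMap_zero, abs_neg, abs_of_pos hr] at h2
    linarith
  have h2 : Integrable (fun p : ℝ × ℂ => f p.2 * Real.log ‖p.2 - (w + circleMap 0 (-r) p.1)‖)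
      (ν.prod volume) := by
    refine integrable_prod_mul_log ν (a := fun θ => w + circleMap 0 (-r) θ)
      (by fun_prop) (R := ‖w‖ + r) (ae_of_all _ fun θ => ?_) (h := fun _ z => f z)
      (hf.measurable.comp measurable_snd) (C := C) (R' := R) (fun _ _ => hC _) fun _ => hz
    refine (norm_add_le _ _).trans ?_
    rw [norm_circleMap_zero, abs_neg, abs_of_pos hr]
  have h3 : ∀ z, Real.circleAverage f z (-r) * Real.log ‖z - w‖ =
      (2 * π)⁻¹ * ∫ θ, f (circleMap z (-r) θ) * Real.log ‖z - w‖ ∂ν := fun z => by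
    rw [Real.circleAverage, intervalIntegral.integral_of_le (by positivity), smul_eq_mul,
      integral_mul_const, mul_assoc]
  have h4 : ∀ c, f c * (Real.log r + Real.posLog (r⁻¹ * ‖c - w‖)) =
      (2 * π)⁻¹ * ∫ θ, f c * Real.log ‖c - (w + circleMap 0 (-r) θ)‖ ∂ν := fun c => by
    -- The negative radius is chosen for this identity: after translating $f$ to a fixed point $c$,
    -- the kernel is averaged over the circle of positive radius $r$ about $c$, where Jensen's
    -- formula applies.
    have e : ∀ θ, c - (w + circleMap 0 (-r) θ) = circleMap c r θ - w := fun θ => by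
      simp only [circleMap, Complex.ofReal_neg]
      ring
    simp_rw [e]
    rw [← circleAverage_log_norm_sub_const_eq_log_radius_add_posLog hr.ne', Real.circleAverage,
      intervalIntegral.integral_of_le (by positivity), smul_eq_mul, integral_const_mul,
      mul_left_comm]
  simp_rw [h3, h4]
  rw [integral_const_mul, integral_const_mul, ←
    integral_integral_swap (f := fun θ z => f (circleMap z (-r) θ) * Real.log ‖z - w‖) h1, ←
    integral_integral_swap (f := fun θ c => f c * Real.log ‖c - (w + circleMap 0 (-r) θ)‖) h2]
  congr 1
  refine integral_congr_ae (ae_of_all _ fun θ => ?_)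
  dsimp only
  rw [← integral_add_right_eq_self (fun c => f c * Real.log ‖c - (w + circleMap 0 (-r) θ)‖)
    (circleMap 0 (-r) θ)]
  refine integral_congr_ae (ae_of_all _ fun z => ?_)
  dsimp only
  have : z + circleMap 0 (-r) θ = circleMap z (-r) θ := by simp [circleMap]
  rw [this, ← this, add_sub_add_right_eq_sub]

end LogPotential

/-! ### From convergence of potentials to weak convergence -/

section WeakConvergence

open Metric

/-- The difference of the means of `z ↦ log |z - x|` over the circles of radii `2ε` and `ε` about
the origin, a bump function. -/
noncomputable def logBump (ε : ℝ) (x : ℂ) : ℝ :=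
  Real.log (2 * ε) + Real.posLog ((2 * ε)⁻¹ * ‖x‖) - (Real.log ε + Real.posLog (ε⁻¹ * ‖x‖))

theorem log_add_posLog_eq {r : ℝ} (hr : 0 < r) {x : ℝ} (hx : 0 ≤ x) :
    Real.log r + Real.posLog (r⁻¹ * x) = Real.log (max r x) := by
  rcases le_total x r with h | h
  · rw [max_eq_left h, Real.posLog_eq_zero_iff _ |>.2, add_zero]
    rw [abs_of_nonneg (by positivity), inv_mul_le_iff₀ hr]
    linarith
  · have hx0 : 0 < x := hr.trans_le h
    rw [max_eq_right h, Real.posLog_eq_log, Real.log_mul (by positivity) hx0.ne', Real.log_inv]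
    · ring
    · rw [abs_of_nonneg (by positivity), le_inv_mul_iff₀ hr]
      linarith

theorem logBump_eq {ε : ℝ} (hε : 0 < ε) (x : ℂ) :
    logBump ε x = Real.log (max (2 * ε) ‖x‖) - Real.log (max ε ‖x‖) := by
  rw [logBump, log_add_posLog_eq (by positivity) (norm_nonneg x),
    log_add_posLog_eq hε (norm_nonneg x)]

theorem continuous_logBump {ε : ℝ} (hε : 0 < ε) : Continuous (logBump ε) := by
  have h : logBump ε = fun x => Real.log (max (2 * ε) ‖x‖) - Real.log (max ε ‖x‖) :=
    funext (logBump_eq hε)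
  rw [h]
  refine Continuous.sub (Continuous.log (by fun_prop) fun x => ?_)
    (Continuous.log (by fun_prop) fun x => ?_)
  · exact (lt_max_of_lt_left (by positivity)).ne'
  · exact (lt_max_of_lt_left hε).ne'

theorem logBump_nonneg {ε : ℝ} (hε : 0 < ε) (x : ℂ) : 0 ≤ logBump ε x := by
  rw [logBump_eq hε, sub_nonneg]
  exact Real.log_le_log (lt_max_of_lt_left hε) (max_le_max_right _ (by linarith))

theorem logBump_eq_zero {ε : ℝ} (hε : 0 < ε) {x : ℂ} (hx : 2 * ε ≤ ‖x‖) : logBump ε x = 0 := by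
  rw [logBump_eq hε, max_eq_right hx, max_eq_right (by linarith), sub_self]

theorem hasCompactSupport_logBump {ε : ℝ} (hε : 0 < ε) : HasCompactSupport (logBump ε) :=
  HasCompactSupport.of_support_subset_isCompact (isCompact_closedBall 0 (2 * ε)) fun x hx => by
    by_contra h
    rw [mem_closedBall_zero_iff, not_le] at h
    exact hx (logBump_eq_zero hε h.le)

theorem integrable_logBump {ε : ℝ} (hε : 0 < ε) : Integrable (logBump ε) :=
  (continuous_logBump hε).integrable_of_hasCompactSupport (hasCompactSupport_logBump hε)

theorem integral_logBump_pos {ε : ℝ} (hε : 0 < ε) : 0 < ∫ x, logBump ε x := by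
  refine (continuous_logBump hε).integral_pos_of_hasCompactSupport_nonneg_nonzero
    (hasCompactSupport_logBump hε) (logBump_nonneg hε) (x := 0) ?_
  rw [logBump_eq hε, norm_zero, max_eq_left (by positivity), max_eq_left hε.le,
    Real.log_mul (by norm_num) hε.ne', add_sub_cancel_right]
  exact (Real.log_pos (by norm_num)).ne'

/-- Smoothing of a test function by the logarithmic bump. -/
noncomputable def logSmooth (f : ℂ → ℝ) (ε : ℝ) (w : ℂ) : ℝ := ∫ c, f c * logBump ε (c - w)

/-- The bump is nonnegative and vanishes beyond distance $2\varepsilon$, so up to its total mass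
`logSmooth` is a local average of $f$. -/
theorem abs_logSmooth_sub_le {f : ℂ → ℝ} (hf : Continuous f) {C : ℝ} (hC : ∀ z, |f z| ≤ C)
    {ε η : ℝ} (hε : 0 < ε) (hη : ∀ c w, dist c w ≤ 2 * ε → |f c - f w| ≤ η) (w : ℂ) :
    |logSmooth f ε w - (∫ x, logBump ε x) * f w| ≤ (∫ x, logBump ε x) * η := by
  have hi := (integrable_logBump hε).comp_sub_right w
  have h1 : Integrable fun c => f c * logBump ε (c - w) :=
    hi.bdd_mul hf.aestronglyMeasurable (ae_of_all _ fun z => by simpa using hC z)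
  rw [← integral_sub_right_eq_self (logBump ε) w, logSmooth, ← integral_mul_const,
    ← integral_mul_const, ← integral_sub h1 (hi.mul_const _), ← Real.norm_eq_abs]
  refine norm_integral_le_of_norm_le (hi.mul_const η) (ae_of_all _ fun c => ?_)
  have h2 : f c * logBump ε (c - w) - logBump ε (c - w) * f w =
      logBump ε (c - w) * (f c - f w) := by ring
  rw [h2, norm_mul, Real.norm_of_nonneg (logBump_nonneg hε _)]
  by_cases hcw : dist c w ≤ 2 * ε
  · exact mul_le_mul_of_nonneg_left (hη c w hcw) (logBump_nonneg hε _)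
  · rw [logBump_eq_zero hε (by rw [← dist_eq_norm]; linarith), zero_mul, zero_mul]

theorem measurable_circleAverage {f : ℂ → ℝ} (hf : Continuous f) (r : ℝ) :
    Measurable fun z => Real.circleAverage f z r := by
  have h : (fun z => Real.circleAverage f z r) =
      fun z => (2 * π)⁻¹ * ∫ θ in Set.Ioc 0 (2 * π), f (circleMap z r θ) := by
    ext z
    rw [Real.circleAverage, intervalIntegral.integral_of_le (by positivity), smul_eq_mul]
  have hc : Continuous fun p : ℂ × ℝ => f (circleMap p.1 r p.2) := by
    simp only [circleMap]
    fun_prop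
  rw [h]
  exact (hc.stronglyMeasurable.integral_prod_right
    (ν := volume.restrict (Set.Ioc 0 (2 * π)))).measurable.const_mul _

/-- Circle averaging is moved from the kernel onto $f$. This exhibits the smoothed test function as
the logarithmic potential of a bounded, compactly supported density, so no Laplacian or smoothness
of $f$ is needed. -/
theorem logSmooth_eq_integral {f : ℂ → ℝ} (hf : Continuous f) {C R : ℝ}
    (hC : ∀ z, |f z| ≤ C) (hz : ∀ z, R < ‖z‖ → f z = 0) {ε : ℝ} (hε : 0 < ε) (w : ℂ) :
    logSmooth f ε w =
      ∫ z, (Real.circleAverage f z (-(2 * ε)) - Real.circleAverage f z (-ε)) *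
        Real.log ‖z - w‖ := by
  have havg_le : ∀ z r, |Real.circleAverage f z r| ≤ C := fun z r =>
    Real.abs_circleAverage_le_circleAverage_abs.trans <| Real.circleAverage_mono_on_of_le_circle
      (hf.abs.continuousOn.circleIntegrable') fun x _ => hC x
  have havg_zero : ∀ r, 0 < r → ∀ z : ℂ, R + r < ‖z‖ → Real.circleAverage f z (-r) = 0 := by
    intro r hr z hzr
    have : ∀ θ, f (circleMap z (-r) θ) = 0 := fun θ => hz _ (by
      have h2 := norm_sub_le (circleMap z (-r) θ) (circleMap 0 (-r) θ)
      have h3 : circleMap z (-r) θ - circleMap 0 (-r) θ = z := by simp [circleMap]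
      rw [h3, norm_circleMap_zero, abs_neg, abs_of_pos hr] at h2
      linarith)
    simp [Real.circleAverage, this]
  have hI : ∀ r, 0 < r → Integrable fun z => Real.circleAverage f z (-r) * Real.log ‖z - w‖ :=
    fun r hr => integrable_mul_log (measurable_circleAverage hf _) (fun z => havg_le z _)
      (havg_zero r hr) le_rfl
  have hJ : ∀ r, 0 < r → Integrable fun c => f c * (Real.log r + Real.posLog (r⁻¹ * ‖c - w‖)) :=
    fun r hr => by
      refine Continuous.integrable_of_hasCompactSupport ?_ ?_
      · have h : (fun c => f c * (Real.log r + Real.posLog (r⁻¹ * ‖c - w‖))) =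
            fun c => f c * Real.log (max r ‖c - w‖) :=
          funext fun c => by rw [log_add_posLog_eq hr (norm_nonneg _)]
        rw [h]
        exact hf.mul (Continuous.log (by fun_prop) fun x => (lt_max_of_lt_left hr).ne')
      · refine HasCompactSupport.mul_right (HasCompactSupport.of_support_subset_isCompact
          (isCompact_closedBall 0 R) fun x hx => ?_)
        by_contra h
        rw [mem_closedBall_zero_iff, not_le] at h
        exact hx (hz x h)
  simp_rw [sub_mul]
  rw [integral_sub (hI _ (by positivity)) (hI _ hε),
    integral_circleAverage_mul_log hf hC hz (by positivity),
    integral_circleAverage_mul_log hf hC hz hε,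
    ← integral_sub (hJ _ (by positivity)) (hJ _ hε), logSmooth]
  simp only [logBump, mul_sub]

theorem tendsto_integral_logSmooth {ξ : ℕ → Measure ℂ} [∀ N, IsProbabilityMeasure (ξ N)]
    {μ : Measure ℂ} [IsProbabilityMeasure μ] {R : ℝ} (hξ : ∀ N, ∀ᵐ w ∂ξ N, ‖w‖ ≤ R)
    (hμ : ∀ᵐ w ∂μ, ‖w‖ ≤ R)
    (hpot : ∀ᵐ z, Tendsto (fun N => logPotential (ξ N) z) atTop (𝓝 (logPotential μ z)))
    {f : ℂ → ℝ} (hf : Continuous f) {C R' : ℝ}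
    (hC : ∀ z, |f z| ≤ C) (hz : ∀ z, R' < ‖z‖ → f z = 0) {ε : ℝ} (hε : 0 < ε) :
    Tendsto (fun N => ∫ w, logSmooth f ε w ∂ξ N) atTop (𝓝 (∫ w, logSmooth f ε w ∂μ)) := by
  have havg_le : ∀ z r, |Real.circleAverage f z r| ≤ C := fun z r =>
    Real.abs_circleAverage_le_circleAverage_abs.trans <| Real.circleAverage_mono_on_of_le_circle
      (hf.abs.continuousOn.circleIntegrable') fun x _ => hC x
  have hg : Measurable fun z =>
      Real.circleAverage f z (-(2 * ε)) - Real.circleAverage f z (-ε) :=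
    (measurable_circleAverage hf (-(2 * ε))).sub (measurable_circleAverage hf (-ε))
  have hgC : ∀ z, |Real.circleAverage f z (-(2 * ε)) - Real.circleAverage f z (-ε)| ≤ C + C :=
    fun z => (abs_sub _ _).trans (add_le_add (havg_le _ _) (havg_le _ _))
  have hgz : ∀ z : ℂ, R' + 2 * ε < ‖z‖ →
      Real.circleAverage f z (-(2 * ε)) - Real.circleAverage f z (-ε) = 0 := by
    intro z hzr
    have : ∀ r, 0 ≤ r → r ≤ 2 * ε → ∀ θ, f (circleMap z (-r) θ) = 0 := fun r hr hr' θ => hz _ (by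
      have h2 := norm_sub_le (circleMap z (-r) θ) (circleMap 0 (-r) θ)
      have h3 : circleMap z (-r) θ - circleMap 0 (-r) θ = z := by simp [circleMap]
      rw [h3, norm_circleMap_zero, abs_neg, abs_of_nonneg hr] at h2
      linarith)
    simp [Real.circleAverage, this _ hε.le (by linarith), this (2 * ε) (by positivity) le_rfl]
  have key := tendsto_integral_mul_logPotential hξ hμ hpot hg hgC hgz
  have hswap : ∀ (ν : Measure ℂ) [IsProbabilityMeasure ν], (∀ᵐ w ∂ν, ‖w‖ ≤ R) →
      ∫ z, (Real.circleAverage f z (-(2 * ε)) - Real.circleAverage f z (-ε)) * logPotential ν z =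
        ∫ w, logSmooth f ε w ∂ν := fun ν _ hν => by
    rw [integral_mul_logPotential ν hν hg hgC hgz]
    exact integral_congr_ae (ae_of_all _ fun w => (logSmooth_eq_integral hf hC hz hε w).symm)
  rw [hswap μ hμ] at key
  exact key.congr fun N => hswap (ξ N) (hξ N)

/-- Almost everywhere convergence of logarithmic potentials of probability measures in a fixed disc
implies weak convergence. -/
theorem tendsto_integral_of_tendsto_logPotential {ξ : ℕ → Measure ℂ}
    [∀ N, IsProbabilityMeasure (ξ N)] {μ : Measure ℂ} [IsProbabilityMeasure μ] {R : ℝ}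
    (hξ : ∀ N, ∀ᵐ w ∂ξ N, ‖w‖ ≤ R) (hμ : ∀ᵐ w ∂μ, ‖w‖ ≤ R)
    (hpot : ∀ᵐ z, Tendsto (fun N => logPotential (ξ N) z) atTop (𝓝 (logPotential μ z)))
    (f : BoundedContinuousFunction ℂ ℝ) :
    Tendsto (fun N => ∫ w, f w ∂ξ N) atTop (𝓝 (∫ w, f w ∂μ)) := by
  -- A cutoff equal to $1$ on the disc carrying all the measures; it makes the test function
  -- compactly supported without changing the integrals.
  set χ : ℂ → ℝ := fun z => max 0 (min 1 (R + 1 - ‖z‖)) with hχ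
  have hχ_cont : Continuous χ := by fun_prop
  have hχ_one : ∀ z, ‖z‖ ≤ R → χ z = 1 := fun z hz => by
    simp only [hχ]
    rw [min_eq_left (by linarith), max_eq_right zero_le_one]
  have hχ_zero : ∀ z, R + 1 < ‖z‖ → χ z = 0 := fun z hz => by
    simp only [hχ]
    rw [max_eq_left ((min_le_right _ _).trans (by linarith))]
  have hχ_abs : ∀ z, |χ z| ≤ 1 := fun z => by
    rw [abs_of_nonneg (le_max_left _ _)]
    exact max_le zero_le_one (min_le_left _ _)
  set F : ℂ → ℝ := fun z => f z * χ z with hF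
  have hF_cont : Continuous F := f.continuous.mul hχ_cont
  have hF_zero : ∀ z, R + 1 < ‖z‖ → F z = 0 := fun z hz => by simp [hF, hχ_zero z hz]
  have hF_abs : ∀ z, |F z| ≤ ‖f‖ := fun z => by
    rw [hF, abs_mul]
    have := f.norm_coe_le_norm z
    rw [Real.norm_eq_abs] at this
    nlinarith [hχ_abs z, abs_nonneg (f z), abs_nonneg (χ z)]
  have hF_supp : HasCompactSupport F :=
    HasCompactSupport.of_support_subset_isCompact (isCompact_closedBall 0 (R + 1)) fun x hx => by
      by_contra h
      rw [mem_closedBall_zero_iff, not_le] at h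
      exact hx (hF_zero x h)
  have hfF : ∀ (ν : Measure ℂ), (∀ᵐ w ∂ν, ‖w‖ ≤ R) → ∫ w, f w ∂ν = ∫ w, F w ∂ν := fun ν hν =>
    integral_congr_ae (hν.mono fun w hw => by simp [hF, hχ_one w hw])
  rw [hfF μ hμ]
  refine Tendsto.congr (fun N => (hfF (ξ N) (hξ N)).symm) ?_
  rw [Metric.tendsto_nhds]
  intro η hη
  obtain ⟨ρ, hρ, hρF⟩ := Metric.uniformContinuous_iff.1
    (hF_cont.uniformContinuous_of_tendsto_cocompact hF_supp.is_zero_at_infty) (η / 4) (by positivity)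
  -- The bump has radius $2\varepsilon=\rho/2<\rho$, within the modulus of continuity of $F$.
  set ε := ρ / 4 with hε_def
  have hε : 0 < ε := by positivity
  set I := ∫ x, logBump ε x with hI_def
  have hI : 0 < I := integral_logBump_pos hε
  have happrox := abs_logSmooth_sub_le hF_cont hF_abs hε (η := η / 4) fun c w hcw => by
    have h := hρF (show dist c w < ρ by linarith)
    exact (Real.dist_eq (F c) (F w) ▸ h).le
  have hsm_meas : Measurable (logSmooth F ε) := by
    have h : Continuous fun p : ℂ × ℂ => F p.2 * logBump ε (p.2 - p.1) :=
      (hF_cont.comp continuous_snd).mul ((continuous_logBump hε).comp (by fun_prop))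
    exact (h.stronglyMeasurable.integral_prod_right (ν := volume)).measurable
  have hsm_le : ∀ w, ‖logSmooth F ε w‖ ≤ I * (‖f‖ + η / 4) := fun w => by
    have h1 := abs_sub_abs_le_abs_sub (logSmooth F ε w) (I * F w)
    have h2 : |I * F w| ≤ I * ‖f‖ := by
      rw [abs_mul, abs_of_pos hI]
      exact mul_le_mul_of_nonneg_left (hF_abs w) hI.le
    rw [Real.norm_eq_abs]
    linarith [happrox w]
  have hdiff : ∀ (ν : Measure ℂ) [IsProbabilityMeasure ν],
      |(∫ w, logSmooth F ε w ∂ν) - I * ∫ w, F w ∂ν| ≤ I * (η / 4) := fun ν _ => by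
    have i1 : Integrable (logSmooth F ε) ν :=
      Integrable.of_bound hsm_meas.aestronglyMeasurable _ (ae_of_all _ hsm_le)
    have i2 : Integrable F ν :=
      Integrable.of_bound hF_cont.aestronglyMeasurable _ (ae_of_all _ hF_abs)
    rw [← integral_const_mul, ← integral_sub i1 (i2.const_mul I), ← Real.norm_eq_abs]
    refine (norm_integral_le_of_norm_le_const (ae_of_all _ happrox)).trans_eq ?_
    rw [probReal_univ, mul_one]
  -- Three errors of size $I\eta/4$ remain: two from smoothing and one from convergence of the
  -- smoothed integrals.
  filter_upwards [Metric.tendsto_nhds.1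
    (tendsto_integral_logSmooth hξ hμ hpot hF_cont hF_abs hF_zero hε) (I * (η / 4))
    (by positivity)] with N hN
  rw [Real.dist_eq] at hN ⊢
  have h1 := abs_le.1 (hdiff (ξ N))
  have h2 := abs_le.1 (hdiff μ)
  have h3 := abs_lt.1 hN
  have h4 : |I * ((∫ w, F w ∂ξ N) - ∫ w, F w ∂μ)| < I * η := by
    rw [abs_lt, mul_sub]
    constructor <;> nlinarith [h1.1, h1.2, h2.1, h2.2, h3.1, h3.2]
  rw [abs_mul, abs_of_pos hI] at h4
  exact lt_of_mul_lt_mul_left h4 hI.le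

end WeakConvergence

/-! ### Product measures: densities and conditioning on coordinates -/

section ProductMeasures

variable {ι : Type*} {X : ι → Type*} [∀ i, MeasurableSpace (X i)]

theorem lmarginal_prod_eq_prod_lintegral [DecidableEq ι] (μ : ∀ i, Measure (X i))
    [∀ i, SigmaFinite (μ i)] {f : ∀ i, X i → ℝ≥0∞} (hf : ∀ i, Measurable (f i)) (s : Finset ι) :
    lmarginal μ s (fun x => ∏ i ∈ s, f i (x i)) = fun _ => ∏ i ∈ s, ∫⁻ y, f i y ∂μ i := by
  have hm : ∀ t : Finset ι, Measurable fun x : ∀ i, X i => ∏ i ∈ t, f i (x i) := fun t =>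
    Finset.measurable_prod t fun i _ => (hf i).comp (measurable_pi_apply i)
  induction s using Finset.induction with
  | empty => simp
  | insert i s hi ih =>
    rw [lmarginal_insert' _ (hm _) hi]
    have h : (fun x : ∀ i, X i => ∫⁻ y, ∏ j ∈ insert i s, f j (Function.update x i y j) ∂μ i) =
        fun x => (∫⁻ y, f i y ∂μ i) * ∏ j ∈ s, f j (x j) := by
      ext x
      rw [← lintegral_mul_const _ (hf i)]
      refine lintegral_congr fun y => ?_
      rw [Finset.prod_insert hi, Function.update_self]
      congr 1
      refine Finset.prod_congr rfl fun j hj => ?_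
      rw [Function.update_of_ne (ne_of_mem_of_not_mem hj hi)]
    rw [h]
    ext x
    rw [Finset.prod_insert hi, ← congrFun ih x]
    exact lintegral_const_mul _ ((hm s).comp measurable_updateFinset)

theorem lintegral_pi_prod_eq_prod_lintegral [Fintype ι] (μ : ∀ i, Measure (X i))
    [∀ i, SigmaFinite (μ i)] {f : ∀ i, X i → ℝ≥0∞} (hf : ∀ i, Measurable (f i)) :
    ∫⁻ x, ∏ i, f i (x i) ∂Measure.pi μ = ∏ i, ∫⁻ y, f i y ∂μ i := by
  classical
  rcases isEmpty_or_nonempty (∀ i, X i) with h | ⟨⟨x⟩⟩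
  · obtain ⟨i, hi⟩ : ∃ i, IsEmpty (X i) := by
      by_contra! hne
      exact h.elim fun i => (hne i).some
    rw [lintegral_of_isEmpty, Finset.prod_eq_zero (Finset.mem_univ i) (lintegral_of_isEmpty _ _)]
  · rw [lintegral_eq_lmarginal_univ x, lmarginal_prod_eq_prod_lintegral μ hf]

theorem pi_withDensity_eq_pi [Fintype ι] (μ : ∀ i, Measure (X i)) [∀ i, SigmaFinite (μ i)]
    {f : ∀ i, X i → ℝ≥0∞} (hf : ∀ i, Measurable (f i))
    [∀ i, SigmaFinite ((μ i).withDensity (f i))] :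
    (Measure.pi μ).withDensity (fun x => ∏ i, f i (x i)) =
      Measure.pi fun i => (μ i).withDensity (f i) := by
  refine (Measure.pi_eq fun s hs => ?_).symm
  rw [withDensity_apply _ (MeasurableSet.univ_pi hs), ← lintegral_indicator (MeasurableSet.univ_pi hs)]
  simp_rw [withDensity_apply _ (hs _), ← lintegral_indicator (hs _)]
  rw [← lintegral_pi_prod_eq_prod_lintegral μ fun i => (hf i).indicator (hs i)]
  refine lintegral_congr fun x => ?_
  by_cases hx : x ∈ Set.univ.pi s
  · rw [Set.indicator_of_mem hx]
    exact Finset.prod_congr rfl fun i _ => (Set.indicator_of_mem (hx i (Set.mem_univ i)) _).symm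
  · rw [Set.indicator_of_notMem hx]
    simp only [Set.mem_pi, Set.mem_univ, true_implies, not_forall] at hx
    obtain ⟨i, hi⟩ := hx
    exact (Finset.prod_eq_zero (Finset.mem_univ i) (Set.indicator_of_notMem hi _)).symm

/-- Fubini: a bound on the conditional probability given all other coordinates, uniform in them,
bounds the total probability. -/
theorem pi_measure_le_of_forall_update [Fintype ι] [DecidableEq ι] (μ : ∀ i, Measure (X i))
    [∀ i, IsProbabilityMeasure (μ i)] {E : Set (∀ i, X i)} (hE : MeasurableSet E) (i : ι)
    {c : ℝ≥0∞} (h : ∀ x, μ i {y | Function.update x i y ∈ E} ≤ c) : Measure.pi μ E ≤ c := by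
  rw [← lintegral_indicator_one hE]
  refine (lintegral_le_of_lmarginal_le {i} (g := fun _ => c) (measurable_one.indicator hE)
    measurable_const ?_).trans_eq (by simp)
  rw [lmarginal_singleton, lmarginal_singleton]
  intro x
  have h1 : (fun y => E.indicator (1 : (∀ i, X i) → ℝ≥0∞) (Function.update x i y)) =
      {y | Function.update x i y ∈ E}.indicator 1 := by
    rfl
  have h2 : ∫⁻ y, E.indicator (1 : (∀ i, X i) → ℝ≥0∞) (Function.update x i y) ∂μ i =
      μ i {y | Function.update x i y ∈ E} := by
    rw [h1]
    exact lintegral_indicator_one (hE.preimage (measurable_update x))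
  exact h2.trans_le ((h x).trans_eq (by simp))

end ProductMeasures

/-! ### The complex Ginibre law -/

section ComplexGinibre

/-- The standard complex Gaussian law. -/
noncomputable def complexGaussian : Measure ℂ :=
  volume.withDensity fun z => ENNReal.ofReal (π⁻¹ * Real.exp (-‖z‖ ^ 2))

theorem integral_exp_neg_mul_norm_sq {b : ℝ} (hb : 0 < b) :
    ∫ z : ℂ, Real.exp (-b * ‖z‖ ^ 2) = π / b := by
  rw [GaussianFourier.integral_rexp_neg_mul_sq_norm hb]
  simp

theorem integrable_exp_neg_mul_norm_sq {b : ℝ} (hb : 0 < b) :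
    Integrable fun z : ℂ => Real.exp (-b * ‖z‖ ^ 2) := by
  by_contra h
  have h1 := integral_exp_neg_mul_norm_sq hb
  rw [integral_undef h] at h1
  have : 0 < π / b := by positivity
  linarith

instance isProbabilityMeasure_complexGaussian : IsProbabilityMeasure complexGaussian := by
  refine ⟨?_⟩
  have hi := (integrable_exp_neg_mul_norm_sq one_pos).const_mul π⁻¹
  have he := integral_exp_neg_mul_norm_sq one_pos
  simp only [neg_mul, one_mul, div_one] at hi he
  rw [complexGaussian, withDensity_apply _ MeasurableSet.univ, Measure.restrict_univ,
    ← ofReal_integral_eq_lintegral_ofReal hi (ae_of_all _ fun _ => by positivity),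
    integral_const_mul, he, inv_mul_cancel₀ Real.pi_ne_zero, ENNReal.ofReal_one]

/-- The density is at most $1/\pi$ and the disc has area $\pi r^2$. -/
theorem complexGaussian_closedBall_le (a : ℂ) {r : ℝ} (hr : 0 ≤ r) :
    complexGaussian (Metric.closedBall a r) ≤ ENNReal.ofReal (r ^ 2) := by
  rw [complexGaussian, withDensity_apply _ Metric.isClosed_closedBall.measurableSet]
  calc _ ≤ ∫⁻ _ in Metric.closedBall a r, ENNReal.ofReal π⁻¹ := by
        refine lintegral_mono fun z => ENNReal.ofReal_le_ofReal ?_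
        exact mul_le_of_le_one_right (by positivity)
          (Real.exp_le_one_iff.2 (neg_nonpos.2 (by positivity)))
    _ = ENNReal.ofReal (r ^ 2) := by
        have h : (NNReal.pi : ℝ≥0∞) = ENNReal.ofReal π := by
          rw [← NNReal.coe_real_pi, ENNReal.ofReal_coe_nnreal]
        rw [lintegral_const, Measure.restrict_apply_univ, Complex.volume_closedBall, h,
          ← ENNReal.ofReal_pow hr, ← ENNReal.ofReal_mul (by positivity),
          ← ENNReal.ofReal_mul (by positivity)]
        congr 1
        field_simp

theorem lintegral_norm_sq_complexGaussian_lt_top :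
    ∫⁻ z, ENNReal.ofReal (‖z‖ ^ 2) ∂complexGaussian < ∞ := by
  have hi := (integrable_exp_neg_mul_norm_sq (b := 1 / 2) (by norm_num)).const_mul (π⁻¹ * 2)
  rw [complexGaussian, lintegral_withDensity_eq_lintegral_mul _ (by fun_prop) (by fun_prop)]
  refine lt_of_le_of_lt (lintegral_mono fun z => ?_) hi.lintegral_lt_top
  rw [Pi.mul_apply, ← ENNReal.ofReal_mul (by positivity)]
  refine ENNReal.ofReal_le_ofReal ?_
  -- Half of the Gaussian exponent absorbs the factor $|z|^2$.
  have h1 : ‖z‖ ^ 2 / 2 ≤ Real.exp (‖z‖ ^ 2 / 2) := by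
    linarith [Real.add_one_le_exp (‖z‖ ^ 2 / 2)]
  have h2 : Real.exp (-‖z‖ ^ 2) * Real.exp (‖z‖ ^ 2 / 2) = Real.exp (-(1 / 2) * ‖z‖ ^ 2) := by
    rw [← Real.exp_add]
    ring_nf
  calc π⁻¹ * Real.exp (-‖z‖ ^ 2) * ‖z‖ ^ 2
      = π⁻¹ * 2 * (Real.exp (-‖z‖ ^ 2) * (‖z‖ ^ 2 / 2)) := by ring
    _ ≤ π⁻¹ * 2 * (Real.exp (-‖z‖ ^ 2) * Real.exp (‖z‖ ^ 2 / 2)) := by gcongr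
    _ = _ := by rw [h2]

/-- The exponential of the Hilbert–Schmidt sum factorises over the entries, which gives their
independence. -/
theorem complexGinibre_eq_pi (N : ℕ) :
    complexGinibre N = Measure.pi fun _ : Fin N => Measure.pi fun _ : Fin N => complexGaussian := by
  have hm : Measurable fun z : ℂ => ENNReal.ofReal (π⁻¹ * Real.exp (-‖z‖ ^ 2)) := by fun_prop
  have : SigmaFinite (volume.withDensity fun z : ℂ =>
      ENNReal.ofReal (π⁻¹ * Real.exp (-‖z‖ ^ 2))) :=
    inferInstanceAs (SigmaFinite complexGaussian)
  have hrow := pi_withDensity_eq_pi (fun _ : Fin N => (volume : Measure ℂ)) fun _ => hm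
  have : SigmaFinite ((Measure.pi fun _ : Fin N => (volume : Measure ℂ)).withDensity
      fun x => ∏ k, ENNReal.ofReal (π⁻¹ * Real.exp (-‖x k‖ ^ 2))) := by
    rw [hrow]
    infer_instance
  have hmat := pi_withDensity_eq_pi
    (fun _ : Fin N => Measure.pi fun _ : Fin N => (volume : Measure ℂ))
    (f := fun _ x => ∏ k, ENNReal.ofReal (π⁻¹ * Real.exp (-‖x k‖ ^ 2)))
    fun _ => Finset.measurable_prod _ fun k _ => hm.comp (measurable_pi_apply k)
  rw [hrow] at hmat
  change _ = Measure.pi fun _ : Fin N => Measure.pi fun _ : Fin N =>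
    volume.withDensity fun z : ℂ => ENNReal.ofReal (π⁻¹ * Real.exp (-‖z‖ ^ 2))
  rw [← hmat, complexGinibre]
  congr 1
  ext Q
  have hrow' : ∀ j, ∏ k, ENNReal.ofReal (π⁻¹ * Real.exp (-‖Q j k‖ ^ 2)) =
      ENNReal.ofReal (∏ k, π⁻¹ * Real.exp (-‖Q j k‖ ^ 2)) := fun j =>
    (ENNReal.ofReal_prod_of_nonneg fun k _ => by positivity).symm
  simp_rw [hrow']
  rw [← ENNReal.ofReal_prod_of_nonneg fun j _ => Finset.prod_nonneg fun k _ => by positivity]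
  congr 1
  simp_rw [Finset.prod_mul_distrib, ← Real.exp_sum, Finset.prod_const, Finset.card_univ,
    Fintype.card_fin, Finset.sum_neg_distrib]
  rw [← pow_mul, inv_pow, sq]

theorem complexGinibre_le_of_forall_update {N : ℕ} {E : Set (Fin N → Fin N → ℂ)}
    (hE : MeasurableSet E) (j k : Fin N) {c : ℝ≥0∞}
    (h : ∀ Q : Fin N → Fin N → ℂ,
      complexGaussian {s | Function.update Q j (Function.update (Q j) k s) ∈ E} ≤ c) :
    complexGinibre N E ≤ c := by
  rw [complexGinibre_eq_pi]
  refine pi_measure_le_of_forall_update _ hE j fun Q => ?_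
  refine pi_measure_le_of_forall_update _ (hE.preimage (measurable_update Q)) k fun r => ?_
  have := h (Function.update Q j r)
  simpa using this

theorem lintegral_entry_norm_sq_complexGinibre {N : ℕ} (j k : Fin N) :
    ∫⁻ Q, ENNReal.ofReal (‖Q j k‖ ^ 2) ∂complexGinibre N =
      ∫⁻ z, ENNReal.ofReal (‖z‖ ^ 2) ∂complexGaussian := by
  rw [complexGinibre_eq_pi]
  have h1 := (measurePreserving_eval (fun _ : Fin N => complexGaussian) k).comp
    (measurePreserving_eval (fun _ : Fin N => Measure.pi fun _ : Fin N => complexGaussian) j)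
  exact h1.lintegral_comp (f := fun z => ENNReal.ofReal (‖z‖ ^ 2)) (by fun_prop)

/-- Markov's inequality for the squared Hilbert–Schmidt norm, whose mean is $N^2$ times the second
moment of one entry. -/
theorem complexGinibre_norm_sq_ge_le (N : ℕ) {t : ℝ} (ht : 0 < t) :
    complexGinibre N {Q | t ≤ ∑ j, ∑ k, ‖Q j k‖ ^ 2} ≤
      ENNReal.ofReal (N ^ 2 / t) * ∫⁻ z, ENNReal.ofReal (‖z‖ ^ 2) ∂complexGaussian := by
  have hm : Measurable fun Q : Fin N → Fin N → ℂ => ∑ j, ∑ k, ENNReal.ofReal (‖Q j k‖ ^ 2) := by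
    fun_prop
  have h := meas_ge_le_lintegral_div (μ := complexGinibre N) hm.aemeasurable
    (ε := ENNReal.ofReal t) (by simpa using ht) ENNReal.ofReal_ne_top
  have hset : {Q : Fin N → Fin N → ℂ | t ≤ ∑ j, ∑ k, ‖Q j k‖ ^ 2} ⊆
      {Q | ENNReal.ofReal t ≤ ∑ j, ∑ k, ENNReal.ofReal (‖Q j k‖ ^ 2)} := by
    intro Q hQ
    simp only [Set.mem_ofPred_eq] at hQ ⊢
    have hrow : ∀ j, ∑ k, ENNReal.ofReal (‖Q j k‖ ^ 2) = ENNReal.ofReal (∑ k, ‖Q j k‖ ^ 2) :=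
      fun j => (ENNReal.ofReal_sum_of_nonneg fun k _ => sq_nonneg _).symm
    simp_rw [hrow]
    rw [← ENNReal.ofReal_sum_of_nonneg fun j _ => Finset.sum_nonneg fun k _ => sq_nonneg _]
    exact ENNReal.ofReal_le_ofReal hQ
  refine (measure_mono hset).trans (h.trans_eq ?_)
  have hrow : ∀ j, ∫⁻ Q, ∑ k, ENNReal.ofReal (‖Q j k‖ ^ 2) ∂complexGinibre N =
      ∑ k, ∫⁻ Q, ENNReal.ofReal (‖Q j k‖ ^ 2) ∂complexGinibre N := fun j =>
    lintegral_finsetSum _ fun k _ => by fun_prop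
  rw [lintegral_finsetSum _ fun j _ => by fun_prop]
  simp_rw [hrow, lintegral_entry_norm_sq_complexGinibre, Finset.sum_const, Finset.card_univ, Fintype.card_fin,
    nsmul_eq_mul]
  rw [ENNReal.ofReal_div_of_pos ht, ENNReal.ofReal_pow (Nat.cast_nonneg N), ENNReal.ofReal_natCast,
    ENNReal.div_eq_inv_mul, ENNReal.div_eq_inv_mul]
  ring

end ComplexGinibre

/-! ### Small-ball estimate for cofactors -/

section SmallBall

open Matrix

/-- Every entry of the inverse of a matrix perturbed by a complex Ginibre matrix is controlled
with high probability. -/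
theorem complexGinibre_adjugate_gt_le {N : ℕ} (M : Matrix (Fin N) (Fin N) ℂ) {δ t : ℝ}
    (hδ : 0 < δ) (ht : 0 < t) (j k : Fin N) :
    complexGinibre N {Q | t * ‖(M + (δ : ℂ) • Matrix.of Q).det‖ <
        ‖(M + (δ : ℂ) • Matrix.of Q).adjugate k j‖} ≤ ENNReal.ofReal ((t * δ)⁻¹ ^ 2) := by
  have hc : Continuous fun Q : Fin N → Fin N → ℂ => M + (δ : ℂ) • Matrix.of Q :=
    continuous_matrix fun a b => by
      simp only [Matrix.add_apply, Matrix.smul_apply, of_apply]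
      fun_prop
  have hE : MeasurableSet {Q : Fin N → Fin N → ℂ | t * ‖(M + (δ : ℂ) • Matrix.of Q).det‖ <
      ‖(M + (δ : ℂ) • Matrix.of Q).adjugate k j‖} :=
    (isOpen_lt (continuous_const.mul hc.matrix_det.norm)
      (hc.matrix_adjugate.matrix_elem k j).norm).measurableSet
  refine complexGinibre_le_of_forall_update hE j k fun Q => ?_
  set A := M + (δ : ℂ) • Matrix.of Q with hA
  -- The cofactor at $(j,k)$. It does not depend on the entry $s$ in that position, while the
  -- determinant is affine in $s$ with slope $\delta g$.
  set g := (A.updateRow j (Pi.single k 1)).det with hg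
  set v : Fin N → ℂ := M j + (δ : ℂ) • Function.update (Q j) k 0 with hv
  have hQs : ∀ s, M + (δ : ℂ) • Matrix.of (Function.update Q j (Function.update (Q j) k s)) =
      A.updateRow j (v + ((δ : ℂ) * s) • Pi.single k 1) := by
    intro s
    ext a b
    by_cases ha : a = j
    · subst ha
      by_cases hb : b = k
      · subst hb
        simp [hv]
      · simp [hv, hb]
    · simp [hA, updateRow_ne ha, Function.update_of_ne ha]
  have hadj : ∀ s, (M + (δ : ℂ) • Matrix.of (Function.update Q j
      (Function.update (Q j) k s))).adjugate k j = g := fun s => by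
    rw [hQs, adjugate_apply, updateRow_idem]
  have hdet : ∀ s, (M + (δ : ℂ) • Matrix.of (Function.update Q j
      (Function.update (Q j) k s))).det = (A.updateRow j v).det + δ * s * g := fun s => by
    rw [hQs, det_updateRow_add, det_updateRow_smul]
  simp only [Set.mem_ofPred_eq, hadj, hdet]
  -- If the cofactor vanishes, the strict inequality cannot hold; otherwise $s$ lies within
  -- $(t\delta)^{-1}$ of the zero of the affine function.
  by_cases hg0 : g = 0
  · have : {s : ℂ | t * ‖(A.updateRow j v).det + δ * s * g‖ < ‖g‖} = ∅ := by
      ext s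
      simp only [hg0, norm_zero, Set.mem_ofPred_eq, Set.mem_empty_iff_false, iff_false, not_lt]
      positivity
    rw [this, measure_empty]
    exact zero_le
  · refine (measure_mono (t := Metric.closedBall (-((A.updateRow j v).det / (δ * g))) (t * δ)⁻¹)
      fun s hs => ?_).trans (complexGaussian_closedBall_le _ (by positivity))
    have hδ' : (δ : ℂ) ≠ 0 := by exact_mod_cast hδ.ne'
    have hgpos : 0 < ‖g‖ := norm_pos_iff.2 hg0
    rw [Set.mem_ofPred_eq] at hs
    have h1 : (A.updateRow j v).det + δ * s * g =
        (δ * g) * (s - -((A.updateRow j v).det / (δ * g))) := by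
      field_simp
      ring
    rw [h1, norm_mul, norm_mul, Complex.norm_real, Real.norm_of_nonneg hδ.le] at hs
    rw [Metric.mem_closedBall, dist_eq_norm, ← one_div, le_div_iff₀ (by positivity)]
    refine le_of_mul_le_mul_right ?_ hgpos
    linarith

/-- Union bound over the $N^2$ cofactors. Using the adjugate rather than the inverse avoids treating
singular matrices separately. -/
theorem complexGinibre_exists_adjugate_gt_le {N : ℕ} (M : Matrix (Fin N) (Fin N) ℂ) {δ t : ℝ}
    (hδ : 0 < δ) (ht : 0 < t) :
    complexGinibre N {Q | ¬ ∀ i j, ‖(M + (δ : ℂ) • Matrix.of Q).adjugate i j‖ ≤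
        t * ‖(M + (δ : ℂ) • Matrix.of Q).det‖} ≤ ENNReal.ofReal (N ^ 2 * (t * δ)⁻¹ ^ 2) := by
  have hset : {Q : Fin N → Fin N → ℂ | ¬ ∀ i j, ‖(M + (δ : ℂ) • Matrix.of Q).adjugate i j‖ ≤
        t * ‖(M + (δ : ℂ) • Matrix.of Q).det‖} ⊆
      ⋃ p : Fin N × Fin N, {Q | t * ‖(M + (δ : ℂ) • Matrix.of Q).det‖ <
        ‖(M + (δ : ℂ) • Matrix.of Q).adjugate p.1 p.2‖} := by
    intro Q hQ
    simp only [Set.mem_ofPred_eq, not_forall, not_le] at hQ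
    obtain ⟨i, j, h⟩ := hQ
    exact Set.mem_iUnion.2 ⟨(i, j), h⟩
  refine (measure_mono hset).trans ((measure_iUnion_fintype_le _ _).trans ?_)
  refine (Finset.sum_le_sum fun p _ =>
    complexGinibre_adjugate_gt_le M hδ ht p.2 p.1).trans_eq ?_
  rw [Finset.sum_const, Finset.card_univ, Fintype.card_prod, Fintype.card_fin, nsmul_eq_mul,
    ENNReal.ofReal_mul (by positivity)]
  congr 1
  rw [ENNReal.ofReal_pow (Nat.cast_nonneg N), ENNReal.ofReal_natCast, sq]
  push_cast
  rfl

open scoped Matrix.Norms.L2Operator in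
theorem Matrix.l2_opNorm_le_sqrt_sum {N : ℕ} (A : Matrix (Fin N) (Fin N) ℂ) :
    ‖A‖ ≤ √(∑ j, ∑ k, ‖A j k‖ ^ 2) := by
  rw [l2_opNorm_def]
  refine ContinuousLinearMap.opNorm_le_bound _ (Real.sqrt_nonneg _) fun x => ?_
  rw [EuclideanSpace.norm_eq, EuclideanSpace.norm_eq, ← Real.sqrt_mul (by positivity)]
  refine Real.sqrt_le_sqrt ?_
  rw [Finset.sum_mul]
  refine Finset.sum_le_sum fun i _ => ?_
  have h : ((toEuclideanLin.trans LinearMap.toContinuousLinearMap) A x) i = ∑ j, A i j * x j := rfl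
  rw [h]
  calc ‖∑ j, A i j * x j‖ ^ 2 ≤ (∑ j, ‖A i j‖ * ‖x j‖) ^ 2 := by
        gcongr
        exact (norm_sum_le _ _).trans_eq (by simp_rw [norm_mul])
    _ ≤ _ := Finset.sum_mul_sq_le_sq_mul_sq _ _ _

end SmallBall

/-! ### The symbol curve is Lebesgue-null -/

section SymbolCurve

/-- Termwise $|e^{i\nu x}-e^{i\nu y}|\le|\nu||x-y|$; the weight $1+|\nu|$ makes the sum converge. -/
theorem lipschitzWith_toeplitzSymbol_exp {a : ℤ → ℂ}
    (ha : Summable fun ν : ℤ => (1 + |(ν : ℝ)|) * ‖a ν‖) :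
    ∃ K, LipschitzWith K fun θ : ℝ => toeplitzSymbol a (Circle.exp θ) := by
  have ha1 : Summable fun ν => ‖a ν‖ := Summable.of_nonneg_of_le (fun _ => norm_nonneg _)
    (fun ν => le_mul_of_one_le_left (norm_nonneg _) (by simp)) ha
  have ha2 : Summable fun ν : ℤ => |(ν : ℝ)| * ‖a ν‖ := Summable.of_nonneg_of_le
    (fun _ => by positivity)
    (fun ν => mul_le_mul_of_nonneg_right (by linarith) (norm_nonneg _)) ha
  refine ⟨Real.toNNReal (∑' ν : ℤ, |(ν : ℝ)| * ‖a ν‖), LipschitzWith.of_dist_le_mul fun x y => ?_⟩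
  rw [Real.coe_toNNReal _ (tsum_nonneg fun _ => by positivity), dist_eq_norm, toeplitzSymbol,
    toeplitzSymbol, ← (summable_toeplitzSymbol ha1 _).tsum_sub (summable_toeplitzSymbol ha1 _),
    ← tsum_mul_right]
  have hterm : ∀ ν : ℤ, ‖a ν * (Circle.exp x : ℂ) ^ ν - a ν * (Circle.exp y : ℂ) ^ ν‖ ≤
      |(ν : ℝ)| * ‖a ν‖ * dist x y := by
    intro ν
    have h1 : (Circle.exp x : ℂ) ^ ν - (Circle.exp y : ℂ) ^ ν = (Circle.exp y : ℂ) ^ ν *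
        (Complex.exp (Complex.I * ((ν * (x - y) : ℝ) : ℂ)) - 1) := by
      rw [mul_sub, mul_one, Circle.coe_exp, Circle.coe_exp, ← Complex.exp_int_mul,
        ← Complex.exp_int_mul, ← Complex.exp_add]
      congr 2
      push_cast
      ring
    rw [← mul_sub, h1, norm_mul, norm_mul, norm_zpow, Circle.norm_coe, one_zpow, one_mul]
    calc ‖a ν‖ * ‖Complex.exp (Complex.I * ((ν * (x - y) : ℝ) : ℂ)) - 1‖
        ≤ ‖a ν‖ * ‖(ν * (x - y) : ℝ)‖ := by
          gcongr
          exact Real.norm_exp_I_mul_ofReal_sub_one_le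
      _ = |(ν : ℝ)| * ‖a ν‖ * dist x y := by
          rw [norm_mul, Real.norm_eq_abs, Real.norm_eq_abs, Real.dist_eq]
          ring
  have hs : Summable fun ν : ℤ => |(ν : ℝ)| * ‖a ν‖ * dist x y := ha2.mul_right _
  have hs' := Summable.of_nonneg_of_le (fun _ => norm_nonneg _) hterm hs
  exact (norm_tsum_le_tsum_norm hs').trans (hs'.tsum_le_tsum hterm hs)

/-- The image has Hausdorff dimension at most $1<2$. -/
theorem volume_range_eq_zero_of_lipschitzWith {f : ℝ → ℂ} {K : ℝ≥0} (hf : LipschitzWith K f) :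
    volume (Set.range f) = 0 := by
  have h1 : dimH (Set.range f) < (2 : ℝ≥0) :=
    (hf.dimH_range_le.trans_eq Real.dimH_univ).trans_lt (by norm_num)
  have h2 := hausdorffMeasure_of_dimH_lt h1
  have h3 : (volume : Measure ℂ) ≪ Measure.hausdorffMeasure (Module.finrank ℝ ℂ : ℝ) :=
    Measure.absolutelyContinuous_isAddHaarMeasure _ _
  rw [Complex.finrank_real_complex] at h3
  exact h3 (by simpa using h2)

theorem ae_forall_toeplitzSymbol_ne {a : ℤ → ℂ}
    (ha : Summable fun ν : ℤ => (1 + |(ν : ℝ)|) * ‖a ν‖) :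
    ∀ᵐ z : ℂ, ∀ ζ, toeplitzSymbol a ζ ≠ z := by
  obtain ⟨K, hK⟩ := lipschitzWith_toeplitzSymbol_exp ha
  have h := measure_eq_zero_iff_ae_notMem.1 (volume_range_eq_zero_of_lipschitzWith hK)
  filter_upwards [h] with z hz ζ hζ
  obtain ⟨θ, rfl⟩ := Circle.exp_surjective ζ
  exact hz ⟨θ, hζ⟩

end SymbolCurve

/-! ### The limit measure and its potential -/

section SymbolMeasure

theorem toMeasure_symbolMeasure {a : ℤ → ℂ} (ha : Summable fun ν => ‖a ν‖) :
    (symbolMeasure a : Measure ℂ) = Real.toNNReal (2 * π)⁻¹ •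
      ((volume : Measure ℝ).restrict (Set.Ioc (-π) π)).map
        fun θ => toeplitzSymbol a (Circle.exp θ) := by
  rw [symbolMeasure, FiniteMeasure.toMeasure_map, FiniteMeasure.toMeasure_smul, Measure.map_smul]
  congr 1
  exact Measure.map_map (continuous_toeplitzSymbol ha).measurable Circle.exp.continuous.measurable

theorem isProbabilityMeasure_symbolMeasure {a : ℤ → ℂ} (ha : Summable fun ν => ‖a ν‖) :
    IsProbabilityMeasure (symbolMeasure a : Measure ℂ) := by
  have hm : Measurable fun θ : ℝ => toeplitzSymbol a (Circle.exp θ) :=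
    ((continuous_toeplitzSymbol ha).comp Circle.exp.continuous).measurable
  refine ⟨?_⟩
  rw [toMeasure_symbolMeasure ha, Measure.smul_apply, Measure.map_apply hm MeasurableSet.univ,
    Set.preimage_univ, Measure.restrict_apply_univ, Real.volume_Ioc, ENNReal.smul_def, smul_eq_mul,
    ← ENNReal.ofReal, ← ENNReal.ofReal_mul (by positivity), sub_neg_eq_add, ← two_mul,
    inv_mul_cancel₀ (by positivity), ENNReal.ofReal_one]

theorem ae_symbolMeasure_norm_le {a : ℤ → ℂ} (ha : Summable fun ν => ‖a ν‖) :
    ∀ᵐ w ∂(symbolMeasure a : Measure ℂ), ‖w‖ ≤ ∑' ν, ‖a ν‖ := by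
  have hm : Measurable fun θ : ℝ => toeplitzSymbol a (Circle.exp θ) :=
    ((continuous_toeplitzSymbol ha).comp Circle.exp.continuous).measurable
  rw [toMeasure_symbolMeasure ha]
  refine Measure.ae_smul_measure ?_ _
  rw [ae_map_iff hm.aemeasurable (isClosed_le continuous_norm continuous_const).measurableSet]
  exact ae_of_all _ fun θ => norm_toeplitzSymbol_le ha _

theorem logPotential_symbolMeasure {a : ℤ → ℂ} (ha : Summable fun ν => ‖a ν‖) (z : ℂ) :
    logPotential (symbolMeasure a) z =
      (2 * π)⁻¹ * ∫ θ in -π..π, Real.log ‖z - toeplitzSymbol a (Circle.exp θ)‖ := by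
  have hm : Measurable fun θ : ℝ => toeplitzSymbol a (Circle.exp θ) :=
    ((continuous_toeplitzSymbol ha).comp Circle.exp.continuous).measurable
  have hl : Measurable fun w : ℂ => Real.log ‖z - w‖ := by fun_prop
  rw [logPotential, toMeasure_symbolMeasure ha, integral_smul_nnreal_measure,
    integral_map hm.aemeasurable hl.aestronglyMeasurable,
    intervalIntegral.integral_of_le (by linarith [Real.pi_pos]), NNReal.smul_def, smul_eq_mul,
    Real.coe_toNNReal _ (by positivity)]

end SymbolMeasure

/-! ### The empirical eigenvalue measure and its potential -/

section EmpiricalMeasure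

open Matrix

theorem integral_sum_diracMeasure (s : Multiset ℂ) (f : ℂ → ℝ) :
    Integrable f ((s.map diracMeasure).sum : FiniteMeasure ℂ) ∧
      ∫ w, f w ∂((s.map diracMeasure).sum : FiniteMeasure ℂ) = (s.map f).sum := by
  induction s using Multiset.induction with
  | empty => simp
  | cons z s ih =>
    have h1 : Integrable f (diracMeasure z : Measure ℂ) := integrable_dirac (by simp)
    have h2 : ∫ w, f w ∂(diracMeasure z : Measure ℂ) = f z := integral_dirac f z
    simp only [Multiset.map_cons, Multiset.sum_cons, FiniteMeasure.toMeasure_add]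
    exact ⟨h1.add_measure ih.1, by rw [integral_add_measure h1 ih.1, h2, ih.2]⟩

theorem ae_sum_diracMeasure {p : ℂ → Prop} (s : Multiset ℂ) (h : ∀ z ∈ s, p z) :
    ∀ᵐ w ∂((s.map diracMeasure).sum : FiniteMeasure ℂ).toMeasure, p w := by
  induction s using Multiset.induction with
  | empty => simp
  | cons z s ih =>
    have h1 : ∀ᵐ w ∂(diracMeasure z : Measure ℂ), p w := by
      have : (ae (diracMeasure z : Measure ℂ)) = pure z := ae_dirac_eq z
      rw [this]
      exact h z (Multiset.mem_cons_self z s)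
    simp only [Multiset.map_cons, Multiset.sum_cons, FiniteMeasure.toMeasure_add]
    exact ae_add_measure_iff.2 ⟨h1, ih fun w hw => h w (Multiset.mem_cons_of_mem hw)⟩

theorem sum_diracMeasure_univ (s : Multiset ℂ) :
    ((s.map diracMeasure).sum : FiniteMeasure ℂ).toMeasure Set.univ = s.card := by
  induction s using Multiset.induction with
  | empty => simp
  | cons z s ih =>
    have h1 : (diracMeasure z : Measure ℂ) Set.univ = 1 := measure_univ (μ := Measure.dirac z)
    simp only [Multiset.map_cons, Multiset.sum_cons, FiniteMeasure.toMeasure_add,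
      Measure.add_apply, h1, ih, Multiset.card_cons]
    push_cast
    ring

theorem isProbabilityMeasure_empiricalMeasure {N : ℕ} (hN : N ≠ 0) (A : Matrix (Fin N) (Fin N) ℂ) :
    IsProbabilityMeasure (empiricalMeasure A : Measure ℂ) := by
  refine ⟨?_⟩
  rw [empiricalMeasure, FiniteMeasure.toMeasure_smul, Measure.smul_apply, sum_diracMeasure_univ,
    card_roots_charpoly, Fintype.card_fin, ENNReal.smul_def, smul_eq_mul,
    ENNReal.coe_inv (by exact_mod_cast hN), ENNReal.coe_natCast,
    ENNReal.inv_mul_cancel (by exact_mod_cast hN) (ENNReal.natCast_ne_top N)]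

open scoped Matrix.Norms.L2Operator in
theorem ae_empiricalMeasure_norm_le {N : ℕ} (A : Matrix (Fin N) (Fin N) ℂ) :
    ∀ᵐ w ∂(empiricalMeasure A : Measure ℂ), ‖w‖ ≤ ‖A‖ := by
  rw [empiricalMeasure, FiniteMeasure.toMeasure_smul]
  exact Measure.ae_smul_measure
    (ae_sum_diracMeasure _ fun z hz => A.norm_le_of_mem_roots_charpoly hz) _

/-- The determinant is the product of $z-\lambda$ over the eigenvalues. Nonvanishing is needed
because of the convention $\log0=0$, under which the logarithm of a product with a zero factor need
not be the sum. -/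
theorem logPotential_empiricalMeasure {N : ℕ} (A : Matrix (Fin N) (Fin N) ℂ) {z : ℂ}
    (hz : (scalar (Fin N) z - A).det ≠ 0) :
    logPotential (empiricalMeasure A) z = Real.log ‖(scalar (Fin N) z - A).det‖ / N := by
  have hprod : (scalar (Fin N) z - A).det = (A.charpoly.roots.map fun r => z - r).prod := by
    rw [← eval_charpoly, (IsAlgClosed.splits A.charpoly).eval_eq_prod_roots_of_monic
      A.charpoly_monic]
  have hlog : ∀ s : Multiset ℂ, (s.map fun r => z - r).prod ≠ 0 →
      (s.map fun r => Real.log ‖z - r‖).sum = Real.log ‖(s.map fun r => z - r).prod‖ := by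
    intro s
    induction s using Multiset.induction with
    | empty => simp
    | cons r s ih =>
      intro h
      simp only [Multiset.map_cons, Multiset.prod_cons, Multiset.sum_cons] at h ⊢
      rw [norm_mul, Real.log_mul (norm_ne_zero_iff.2 (left_ne_zero_of_mul h))
        (norm_ne_zero_iff.2 (right_ne_zero_of_mul h)), ih (right_ne_zero_of_mul h)]
  rw [logPotential, empiricalMeasure, FiniteMeasure.toMeasure_smul, integral_smul_nnreal_measure,
    (integral_sum_diracMeasure _ _).2, hlog _ (hprod ▸ hz), ← hprod, NNReal.smul_def, smul_eq_mul]
  push_cast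
  ring

theorem ae_det_scalar_sub_ne_zero {N : ℕ} (A : Matrix (Fin N) (Fin N) ℂ) :
    ∀ᵐ z : ℂ, (scalar (Fin N) z - A).det ≠ 0 := by
  have h : (A.charpoly.roots.toFinset : Set ℂ).Countable := Finset.countable_toSet _
  filter_upwards [measure_eq_zero_iff_ae_notMem.1 (h.measure_zero volume)] with z hz h0
  refine hz ?_
  rw [← eval_charpoly] at h0
  simpa [A.charpoly_monic.ne_zero] using h0

end EmpiricalMeasure

/-! ### Deterministic convergence criterion and Borel–Cantelli -/

section Convergence

open Matrix

theorem toeplitzMatrix_sub_single (a : ℤ → ℂ) (z : ℂ) (N : ℕ) :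
    toeplitzMatrix (a - Pi.single 0 z) N = toeplitzMatrix a N - scalar (Fin N) z := by
  ext j k
  have : ((j : ℤ) - k = 0) ↔ j = k := by
    rw [sub_eq_zero, Nat.cast_inj, Fin.val_inj]
  simp only [toeplitzMatrix, of_apply, Pi.sub_apply, Pi.single_apply, Matrix.sub_apply,
    scalar_apply, diagonal_apply, this]

theorem summable_norm_sub_single {a : ℤ → ℂ} (ha : Summable fun ν => ‖a ν‖) (z : ℂ) :
    Summable fun ν => ‖(a - Pi.single 0 z : ℤ → ℂ) ν‖ := by
  have h : Summable fun ν => ‖(Pi.single 0 z : ℤ → ℂ) ν‖ :=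
    summable_of_ne_finset_zero (s := {0}) fun ν hν => by
      rw [Pi.single_eq_of_ne (by simpa using hν), norm_zero]
  exact Summable.of_nonneg_of_le (fun _ => norm_nonneg _) (fun ν => norm_sub_le _ _) (ha.add h)

theorem toeplitzSymbol_sub_single {a : ℤ → ℂ} (ha : Summable fun ν => ‖a ν‖) (z : ℂ) (ζ : Circle) :
    toeplitzSymbol (a - Pi.single 0 z) ζ = toeplitzSymbol a ζ - z := by
  have h : HasSum (fun ν => (Pi.single 0 z : ℤ → ℂ) ν * (ζ : ℂ) ^ ν) z := by
    convert hasSum_single (0 : ℤ) (f := fun ν => (Pi.single 0 z : ℤ → ℂ) ν * (ζ : ℂ) ^ ν) ?_ using 1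
    · simp
    · intro ν hν
      rw [Pi.single_eq_of_ne hν, zero_mul]
  simp only [toeplitzSymbol, Pi.sub_apply, sub_mul]
  rw [(summable_toeplitzSymbol ha ζ).tsum_sub h.summable, h.tsum_eq]

open scoped Matrix.Norms.L2Operator in
/-- Deterministic criterion for convergence of the empirical eigenvalue measures of perturbed
Toeplitz matrices: small perturbations and subexponential resolvent bounds suffice. -/
theorem tendsto_empiricalMeasure {a : ℤ → ℂ} (ha : Summable fun ν : ℤ => (1 + |(ν : ℝ)|) * ‖a ν‖)
    {E : ∀ N : ℕ, Matrix (Fin N) (Fin N) ℂ} (hE : Tendsto (fun N => ‖E N‖) atTop (𝓝 0))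
    {t : ℕ → ℝ} (ht : Tendsto (fun N => Real.log (t N) / N) atTop (𝓝 0))
    (ht1 : ∀ᶠ N in atTop, 1 ≤ t N)
    (hadj : ∀ᵐ z : ℂ, ∀ᶠ N : ℕ in atTop, ∀ i j,
      ‖(toeplitzMatrix a N - scalar (Fin N) z + E N).adjugate i j‖ ≤
        t N * ‖(toeplitzMatrix a N - scalar (Fin N) z + E N).det‖) :
    Tendsto (fun N => empiricalMeasure (toeplitzMatrix a N + E N)) atTop (𝓝 (symbolMeasure a)) := by
  have ha1 : Summable fun ν => ‖a ν‖ := Summable.of_nonneg_of_le (fun _ => norm_nonneg _)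
    (fun ν => le_mul_of_one_le_left (norm_nonneg _) (by simp)) ha
  have hpot : ∀ᵐ z : ℂ, Tendsto
      (fun N => logPotential (empiricalMeasure (toeplitzMatrix a N + E N)) z) atTop
      (𝓝 (logPotential (symbolMeasure a) z)) := by
    filter_upwards [hadj, ae_forall_toeplitzSymbol_ne ha,
      ae_all_iff.2 fun N => ae_det_scalar_sub_ne_zero (toeplitzMatrix a N + E N)] with z h1 h2 h3
    have hneg : ∀ N, toeplitzMatrix a N - scalar (Fin N) z + E N =
        -(scalar (Fin N) z - (toeplitzMatrix a N + E N)) := fun N => by abel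
    have hdet : ∀ N, ‖(toeplitzMatrix a N - scalar (Fin N) z + E N).det‖ =
        ‖(scalar (Fin N) z - (toeplitzMatrix a N + E N)).det‖ := fun N => by
      rw [hneg, det_neg, norm_mul, norm_pow, norm_neg, norm_one, one_pow, one_mul]
    -- Subtracting $z$ from the coefficient $a_0$ replaces $p$ by $p-z$, which has no zeros on the
    -- circle.
    have key := tendsto_log_norm_det (summable_norm_sub_single ha1 z)
      (fun ζ => by
        rw [toeplitzSymbol_sub_single ha1]
        exact sub_ne_zero.2 (h2 ζ)) hE ht ht1
      (Eventually.of_forall fun N => by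
        rw [toeplitzMatrix_sub_single, ← norm_ne_zero_iff, hdet]
        exact norm_ne_zero_iff.2 (h3 N))
      (by simpa only [toeplitzMatrix_sub_single] using h1)
    simp only [toeplitzMatrix_sub_single, hdet, toeplitzSymbol_sub_single ha1] at key
    rw [logPotential_symbolMeasure ha1]
    simp_rw [logPotential_empiricalMeasure _ (h3 _), norm_sub_rev z (toeplitzSymbol a _)]
    exact key
  rw [FiniteMeasure.tendsto_iff_forall_integral_tendsto]
  intro f
  have hprob := isProbabilityMeasure_symbolMeasure ha1
  obtain ⟨N₀, hN₀⟩ := eventually_atTop.1 (hE.eventually (gt_mem_nhds one_pos))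
  -- Shifting the index discards $N=0$, where the empirical measure is not a probability measure,
  -- and ensures $\|E_N\|<1$, so that all spectra lie in one disc.
  rw [← tendsto_add_atTop_iff_nat (N₀ + 1)]
  have hprob' : ∀ N, IsProbabilityMeasure
      (empiricalMeasure (toeplitzMatrix a (N + (N₀ + 1)) + E (N + (N₀ + 1))) : Measure ℂ) :=
    fun N => isProbabilityMeasure_empiricalMeasure (by omega) _
  refine tendsto_integral_of_tendsto_logPotential (R := (∑' ν, ‖a ν‖) + 1)
    (ξ := fun N =>
      (empiricalMeasure (toeplitzMatrix a (N + (N₀ + 1)) + E (N + (N₀ + 1))) : Measure ℂ))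
    (fun N => ?_) ?_ ?_ f
  · filter_upwards [ae_empiricalMeasure_norm_le
      (toeplitzMatrix a (N + (N₀ + 1)) + E (N + (N₀ + 1)))] with w hw
    have h1 := norm_toeplitzMatrix_le ha1 (N + (N₀ + 1))
    have h2 := hN₀ (N + (N₀ + 1)) (by omega)
    linarith [norm_add_le (toeplitzMatrix a (N + (N₀ + 1))) (E (N + (N₀ + 1)))]
  · filter_upwards [ae_symbolMeasure_norm_le ha1] with w hw
    linarith
  · filter_upwards [hpot] with z hz
    exact (tendsto_add_atTop_iff_nat (N₀ + 1)).2 hz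

/-- Borel–Cantelli for events whose probabilities are eventually dominated by a summable
sequence. -/
theorem ae_eventually_notMem_of_le {Ω : Type*} [MeasurableSpace Ω] {P : Measure Ω}
    {s : ℕ → Set Ω} {u : ℕ → ℝ} (hu : Summable u) (h : ∀ᶠ N in atTop, P (s N) ≤ ENNReal.ofReal (u N)) :
    ∀ᵐ ω ∂P, ∀ᶠ N in atTop, ω ∉ s N := by
  obtain ⟨N₀, hN₀⟩ := eventually_atTop.1 h
  have hsum : ∑' N, P (s (N + N₀)) ≠ ∞ := by
    refine ne_top_of_le_ne_top ((summable_nat_add_iff N₀).2 hu).tsum_ofReal_ne_top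
      (ENNReal.tsum_le_tsum fun N => hN₀ (N + N₀) (by omega))
  filter_upwards [ae_eventually_notMem hsum] with ω hω
  obtain ⟨M, hM⟩ := eventually_atTop.1 hω
  refine eventually_atTop.2 ⟨M + N₀, fun N hN => ?_⟩
  have := hM (N - N₀) (by omega)
  rwa [Nat.sub_add_cancel (by omega)] at this

end Convergence

/-! ### Almost sure norm and cofactor bounds -/

section AlmostSure

open Matrix

variable {Ω : Type*} [MeasurableSpace Ω] {P : Measure Ω} {Q : (N : ℕ) → Ω → Fin N → Fin N → ℂ}

open scoped Matrix.Norms.L2Operator in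
-- With $3/2<\delta_2<\delta_1$, the event $\|Q\|_{\mathrm{HS}}\ge N^{\delta_2}$ has probability
-- $O(N^{2-2\delta_2})$, which is summable; this is where the threshold $3/2$ enters. Outside it,
-- $\|\delta Q\|=O(N^{\delta_2-\delta_1})$.
theorem ae_tendsto_norm_smul_ginibre {δ₁ : ℝ} (hδ₁ : 3 / 2 < δ₁) {δ : ℕ → ℝ}
    (hδ : δ =O[atTop] fun N : ℕ => (N : ℝ) ^ (-δ₁)) (hQ : ∀ N, HasLaw (Q N) (complexGinibre N) P) :
    ∀ᵐ ω ∂P, Tendsto (fun N => ‖(δ N : ℂ) • Matrix.of (Q N ω)‖) atTop (𝓝 0) := by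
  obtain ⟨δ₂, h2, h21⟩ := exists_between hδ₁
  obtain ⟨K, hK⟩ := hδ.bound
  set κ := (∫⁻ z, ENNReal.ofReal (‖z‖ ^ 2) ∂complexGaussian).toReal with hκ
  have hκ' : ∫⁻ z, ENNReal.ofReal (‖z‖ ^ 2) ∂complexGaussian = ENNReal.ofReal κ :=
    (ENNReal.ofReal_toReal lintegral_norm_sq_complexGaussian_lt_top.ne).symm
  have hsum : Summable fun N : ℕ => (N : ℝ) ^ (2 - 2 * δ₂) * κ :=
    (Real.summable_nat_rpow.2 (by linarith)).mul_right κ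
  have hBC := ae_eventually_notMem_of_le (P := P)
    (s := fun N => {ω | (N : ℝ) ^ (2 * δ₂) ≤ ∑ j, ∑ k, ‖Q N ω j k‖ ^ 2}) hsum (by
      filter_upwards [eventually_gt_atTop 0] with N hN
      have hN' : (0 : ℝ) < N := by exact_mod_cast hN
      have hmeas : MeasurableSet {R : Fin N → Fin N → ℂ |
          (N : ℝ) ^ (2 * δ₂) ≤ ∑ j, ∑ k, ‖R j k‖ ^ 2} :=
        measurableSet_le measurable_const (by fun_prop)
      have h := complexGinibre_norm_sq_ge_le N (t := (N : ℝ) ^ (2 * δ₂)) (by positivity)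
      rw [← (hQ N).map_eq, Measure.map_apply_of_aemeasurable (hQ N).aemeasurable hmeas, hκ',
        ← ENNReal.ofReal_mul (by positivity), ← Real.rpow_natCast, ← Real.rpow_sub hN'] at h
      exact_mod_cast h)
  filter_upwards [hBC] with ω hω
  have hlim : Tendsto (fun N : ℕ => K * (N : ℝ) ^ (-(δ₁ - δ₂))) atTop (𝓝 0) := by
    have := ((tendsto_rpow_neg_atTop (sub_pos.2 h21)).comp tendsto_natCast_atTop_atTop).const_mul K
    rwa [mul_zero] at this
  refine squeeze_zero' (Eventually.of_forall fun _ => norm_nonneg _) ?_ hlim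
  filter_upwards [hω, hK, eventually_gt_atTop 0] with N h1 h3 hN
  have hN' : (0 : ℝ) < N := by exact_mod_cast hN
  rw [not_le] at h1
  have h4 : ‖Matrix.of (Q N ω)‖ ≤ (N : ℝ) ^ δ₂ := by
    refine (l2_opNorm_le_sqrt_sum _).trans (Real.sqrt_le_iff.2 ⟨by positivity, ?_⟩)
    rw [← Real.rpow_natCast, ← Real.rpow_mul hN'.le, mul_comm]
    exact_mod_cast h1.le
  rw [Real.norm_of_nonneg (by positivity : (0 : ℝ) ≤ (N : ℝ) ^ (-δ₁))] at h3
  rw [norm_smul, Complex.norm_real]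
  calc ‖δ N‖ * ‖Matrix.of (Q N ω)‖ ≤ K * (N : ℝ) ^ (-δ₁) * (N : ℝ) ^ δ₂ :=
        mul_le_mul h3 h4 (norm_nonneg _) ((norm_nonneg _).trans h3)
    _ = K * (N : ℝ) ^ (-(δ₁ - δ₂)) := by
        rw [mul_assoc, ← Real.rpow_add hN']
        ring_nf

/-- With $t=N^2/\delta$ the failure probability is at most $N^2(t\delta)^{-2}=N^{-2}$.
Borel–Cantelli needs no joint law for different $N$. -/
theorem ae_eventually_adjugate_le {δ : ℕ → ℝ} (hδ : ∀ᶠ N in atTop, 0 < δ N)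
    (hQ : ∀ N, HasLaw (Q N) (complexGinibre N) P) (M : ∀ N : ℕ, Matrix (Fin N) (Fin N) ℂ) :
    ∀ᵐ ω ∂P, ∀ᶠ N : ℕ in atTop, ∀ i j,
      ‖(M N + (δ N : ℂ) • Matrix.of (Q N ω)).adjugate i j‖ ≤
        (N : ℝ) ^ 2 / δ N * ‖(M N + (δ N : ℂ) • Matrix.of (Q N ω)).det‖ := by
  have hBC := ae_eventually_notMem_of_le (P := P)
    (s := fun N => {ω | ¬ ∀ i j, ‖(M N + (δ N : ℂ) • Matrix.of (Q N ω)).adjugate i j‖ ≤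
        (N : ℝ) ^ 2 / δ N * ‖(M N + (δ N : ℂ) • Matrix.of (Q N ω)).det‖})
    (Real.summable_one_div_nat_pow.2 one_lt_two) (by
      filter_upwards [eventually_gt_atTop 0, hδ] with N hN hδN
      have hN' : (0 : ℝ) < N := by exact_mod_cast hN
      have hc : Continuous fun R : Fin N → Fin N → ℂ => M N + (δ N : ℂ) • Matrix.of R :=
        continuous_matrix fun a b => by
          simp only [Matrix.add_apply, Matrix.smul_apply, of_apply]
          fun_prop
      have hmeas : MeasurableSet {R : Fin N → Fin N → ℂ | ¬ ∀ i j,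
          ‖(M N + (δ N : ℂ) • Matrix.of R).adjugate i j‖ ≤
            (N : ℝ) ^ 2 / δ N * ‖(M N + (δ N : ℂ) • Matrix.of R).det‖} := by
        refine MeasurableSet.compl (s := {R | ∀ i j, _}) ?_
        simp only [Set.ofPred_forall]
        exact MeasurableSet.iInter fun i => MeasurableSet.iInter fun j =>
          (isClosed_le (hc.matrix_adjugate.matrix_elem i j).norm
            (continuous_const.mul hc.matrix_det.norm)).measurableSet
      have h := complexGinibre_exists_adjugate_gt_le (M N) hδN
        (t := (N : ℝ) ^ 2 / δ N) (by positivity)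
      rw [← (hQ N).map_eq, Measure.map_apply_of_aemeasurable (hQ N).aemeasurable hmeas] at h
      refine h.trans_eq (congrArg _ ?_)
      field_simp)
  filter_upwards [hBC] with ω hω
  filter_upwards [hω] with N hN
  exact not_not.1 hN

/-- The exceptional null set of $\omega$ depends on $z$; Fubini on $\Omega\times\mathbb C$ exchanges
the quantifiers. -/
theorem ae_ae_eventually_adjugate_le [IsProbabilityMeasure P] {δ : ℕ → ℝ}
    (hδ : ∀ᶠ N in atTop, 0 < δ N) (hQ : ∀ N, HasLaw (Q N) (complexGinibre N) P)
    (T : ∀ N : ℕ, Matrix (Fin N) (Fin N) ℂ) :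
    ∀ᵐ ω ∂P, ∀ᵐ z : ℂ, ∀ᶠ N : ℕ in atTop, ∀ i j,
      ‖(T N - scalar (Fin N) z + (δ N : ℂ) • Matrix.of (Q N ω)).adjugate i j‖ ≤
        (N : ℝ) ^ 2 / δ N *
          ‖(T N - scalar (Fin N) z + (δ N : ℂ) • Matrix.of (Q N ω)).det‖ := by
  -- The random matrices are only almost everywhere measurable; measurable versions make the joint
  -- event measurable for Fubini.
  set Q' : (N : ℕ) → Ω → Fin N → Fin N → ℂ := fun N => (hQ N).aemeasurable.mk (Q N) with hQ'
  have hQQ' : ∀ᵐ ω ∂P, ∀ N, Q N ω = Q' N ω := ae_all_iff.2 fun N => (hQ N).aemeasurable.ae_eq_mk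
  have hQ'm : ∀ N, Measurable (Q' N) := fun N => (hQ N).aemeasurable.measurable_mk
  have hmeas : MeasurableSet {x : Ω × ℂ | ∀ᶠ N : ℕ in atTop, ∀ i j,
      ‖(T N - scalar (Fin N) x.2 + (δ N : ℂ) • Matrix.of (Q' N x.1)).adjugate i j‖ ≤
        (N : ℝ) ^ 2 / δ N *
          ‖(T N - scalar (Fin N) x.2 + (δ N : ℂ) • Matrix.of (Q' N x.1)).det‖} := by
    simp only [eventually_atTop, Set.ofPred_exists, Set.ofPred_forall]
    refine MeasurableSet.iUnion fun n => MeasurableSet.iInter fun N => MeasurableSet.iInter fun _ =>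
      MeasurableSet.iInter fun i => MeasurableSet.iInter fun j => ?_
    have hc : Continuous fun y : (Fin N → Fin N → ℂ) × ℂ =>
        T N - scalar (Fin N) y.2 + (δ N : ℂ) • Matrix.of y.1 :=
      continuous_matrix fun a b => by
        simp only [Matrix.add_apply, Matrix.sub_apply, Matrix.smul_apply, of_apply, scalar_apply,
          diagonal_apply]
        split_ifs <;> fun_prop
    have hcl : IsClosed {y : (Fin N → Fin N → ℂ) × ℂ |
        ‖(T N - scalar (Fin N) y.2 + (δ N : ℂ) • Matrix.of y.1).adjugate i j‖ ≤
          (N : ℝ) ^ 2 / δ N * ‖(T N - scalar (Fin N) y.2 + (δ N : ℂ) • Matrix.of y.1).det‖} :=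
      isClosed_le (hc.matrix_adjugate.matrix_elem i j).norm
        (continuous_const.mul hc.matrix_det.norm)
    have hm : Measurable fun x : Ω × ℂ => (Q' N x.1, x.2) :=
      ((hQ'm N).comp measurable_fst).prodMk measurable_snd
    exact hm hcl.measurableSet
  have key : ∀ᵐ ω ∂P, ∀ᵐ z : ℂ, ∀ᶠ N : ℕ in atTop, ∀ i j,
      ‖(T N - scalar (Fin N) z + (δ N : ℂ) • Matrix.of (Q' N ω)).adjugate i j‖ ≤
        (N : ℝ) ^ 2 / δ N *
          ‖(T N - scalar (Fin N) z + (δ N : ℂ) • Matrix.of (Q' N ω)).det‖ := by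
    rw [Measure.ae_ae_comm hmeas]
    refine ae_of_all _ fun z => ?_
    filter_upwards [ae_eventually_adjugate_le hδ hQ fun N => T N - scalar (Fin N) z, hQQ']
      with ω h1 h2
    simpa only [← h2] using h1
  filter_upwards [key, hQQ'] with ω h1 h2
  simpa only [h2] using h1

end AlmostSure

/-- The lower bound on $\delta$ gives $\log(N^2/\delta)\le2\log N+N^{\delta_0}$, which is sublinear
since $\delta_0<1$. -/
theorem tendsto_log_sq_div_coupling_div {δ₀ : ℝ} (hδ₀_lt : δ₀ < 1) {δ : ℕ → ℝ}
    (hδ_lower : ∀ᶠ N : ℕ in atTop, Real.exp (-(N : ℝ) ^ δ₀) ≤ δ N)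
    (hδ_one : ∀ᶠ N : ℕ in atTop, δ N ≤ 1) :
    Tendsto (fun N : ℕ => Real.log ((N : ℝ) ^ 2 / δ N) / N) atTop (𝓝 0) := by
  have hlogN : Tendsto (fun N : ℕ => Real.log N / N) atTop (𝓝 0) :=
    Real.isLittleO_log_id_atTop.tendsto_div_nhds_zero.comp tendsto_natCast_atTop_atTop
  have hpow : Tendsto (fun N : ℕ => (N : ℝ) ^ (-(1 - δ₀))) atTop (𝓝 0) :=
    (tendsto_rpow_neg_atTop (sub_pos.2 hδ₀_lt)).comp tendsto_natCast_atTop_atTop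
  have hlim : Tendsto (fun N : ℕ => 2 * (Real.log N / N) + (N : ℝ) ^ (-(1 - δ₀))) atTop (𝓝 0) := by
    simpa using (hlogN.const_mul 2).add hpow
  refine squeeze_zero' ?_ ?_ hlim
  · filter_upwards [hδ_lower, hδ_one, eventually_gt_atTop 0] with N h1 h2 hN
    have hN' : (1 : ℝ) ≤ N := by exact_mod_cast hN
    have hδ : 0 < δ N := (Real.exp_pos _).trans_le h1
    refine div_nonneg (Real.log_nonneg ?_) (by linarith)
    rw [le_div_iff₀ hδ]
    nlinarith
  · filter_upwards [hδ_lower, eventually_gt_atTop 0] with N h1 hN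
    have hN' : (0 : ℝ) < N := by exact_mod_cast hN
    have hδ : 0 < δ N := (Real.exp_pos _).trans_le h1
    have h3 := Real.log_le_log (Real.exp_pos _) h1
    rw [Real.log_exp] at h3
    rw [Real.log_div (by positivity) hδ.ne', Real.log_pow, div_le_iff₀ hN', add_mul,
      ← Real.rpow_add_one hN'.ne']
    have h4 : 2 * (Real.log N / N) * N = 2 * Real.log N := by field_simp
    have h5 : -(1 - δ₀) + 1 = δ₀ := by ring
    rw [h4, h5]
    push_cast
    linarith

/-! ### The almost sure limit law -/

theorem theorem1p2
    -- the coefficients of the symbol and their majorant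
    (a : ℤ → ℂ) (m : ℤ → ℝ)
    (hm_pos : ∀ ν, 0 < m ν)
    (hm_even : ∀ ν, m (-ν) = m ν)
    (hm_sum : Summable fun ν : ℤ => (1 + |(ν : ℝ)|) * m ν)
    (ha : ∃ C : ℝ, ∀ ν, ‖a ν‖ ≤ C * m ν)
    -- the coupling constants `δ = δ(N)`
    (δ₀ δ₁ : ℝ) (hδ₀_pos : 0 < δ₀) (hδ₀_lt : δ₀ < 1) (hδ₁ : 3 / 2 < δ₁)
    (δ : ℕ → ℝ)
    (hδ_lower : ∀ᶠ N : ℕ in atTop, Real.exp (-(N : ℝ) ^ δ₀) ≤ δ N)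
    (hδ_upper : δ =O[atTop] fun N : ℕ => (N : ℝ) ^ (-δ₁))
    -- the Gaussian random matrices, on a common probability space
    {Ω : Type*} [MeasurableSpace Ω] (P : Measure Ω) [IsProbabilityMeasure P]
    (Q : (N : ℕ) → Ω → Fin N → Fin N → ℂ)
    (hQ : ∀ N, HasLaw (Q N) (complexGinibre N) P) :
    ∀ᵐ ω ∂P, Tendsto (fun N : ℕ => empiricalMeasure (perturbedToeplitz a N (δ N) (Q N ω)))
      atTop (𝓝 (symbolMeasure a)) := by
  obtain ⟨C, hC⟩ := ha
  have hsum : Summable fun ν : ℤ => (1 + |(ν : ℝ)|) * ‖a ν‖ :=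
    Summable.of_nonneg_of_le (fun _ => by positivity)
      (fun ν => (mul_le_mul_of_nonneg_left (hC ν) (by positivity)).trans_eq
        (by ring : _ = C * ((1 + |(ν : ℝ)|) * m ν))) (hm_sum.mul_left C)
  have hδ_pos : ∀ᶠ N in atTop, 0 < δ N :=
    hδ_lower.mono fun N h => (Real.exp_pos _).trans_le h
  have hδ_one : ∀ᶠ N in atTop, δ N ≤ 1 := by
    have h := hδ_upper.trans_tendsto
      ((tendsto_rpow_neg_atTop (by linarith : 0 < δ₁)).comp tendsto_natCast_atTop_atTop)
    exact h.eventually (ge_mem_nhds one_pos)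
  have ht1 : ∀ᶠ N : ℕ in atTop, 1 ≤ (N : ℝ) ^ 2 / δ N := by
    filter_upwards [hδ_pos, hδ_one, eventually_gt_atTop 0] with N h1 h2 hN
    have hN' : (1 : ℝ) ≤ N := by exact_mod_cast hN
    rw [le_div_iff₀ h1]
    nlinarith
  filter_upwards [ae_tendsto_norm_smul_ginibre hδ₁ hδ_upper hQ,
    ae_ae_eventually_adjugate_le hδ_pos hQ (toeplitzMatrix a)] with ω h1 h2
  exact tendsto_empiricalMeasure hsum h1
    (tendsto_log_sq_div_coupling_div hδ₀_lt hδ_lower hδ_one) ht1 h2
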